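/- Let $k$ be a division ring and $n\ge 0$. Regard $k^n$ as a left and as a right $k$-vector space (scalars acting coordinatewise). A left (right) affine subspace of $k^n$ is a translate of a left (right) vector subspace; it is two-sided if it is both left and right, and purely left if it is left but not right. (The left and right dimensions of a two-sided affine subspace coincide.) Let $f:k^n\to k^n$ be an injective map that sends every left or right affine subspace to a left or right affine subspace. (1) Then $f$ is bijective and preserves dimension: for every left or right affine subspace $A$, $\dim f(A)=\dim A$. Say that a map $h:k^n\to k^n$ has the standard form if $h(x)=\sigma(g(xa)+b)$ for all $x$, where $a\in k$, $b\in k^n$, $\sigma$ is an automorphism of $k$ applied coordinatewise, and $g:k^n\to k^n$ is a left $k$-linear map defined over the centre $Z(k)$, i.e. its matrix in the standard basis has entries in $Z(k)$. Let $P\subset k^n$ be a two-sided affine plane. (2) Suppose $n\ge 3$ and there is a purely left line $L\subset P$ such that $f(L)$ is a left affine subspace. Then $f$ sends every left affine subspace to a left affine subspace of the same dimension, and $f$ has the standard form. (3) Suppose $n\ge 2$ and $f(L)$ is a right affine subspace for every purely left line $L\subset P$. Then $k$ admits an anti-automorphism, and for every anti-automorphism $\varepsilon$ of $k$ the map $\varepsilon\circ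 f$ ($\varepsilon$ applied coordinatewise) sends every left affine subspace to a left affine subspace of the same dimension and has the standard form. -/

import Mathlib

/-- `A ⊆ kⁿ` is a (nonempty) left affine subspace. -/
def IsLeftAffine {k : Type*} [DivisionRing k] {n : ℕ} (A : Set (Fin n → k)) : Prop :=
  A.Nonempty ∧ ∃ S : AffineSubspace k (Fin n → k), (S : Set (Fin n → k)) = A

/-- `A ⊆ kⁿ` is a (nonempty) right affine subspace: here `kⁿ` is a module over the opposite
ring `kᵐᵒᵖ`, acting by right multiplication on each coordinate. -/
def IsRightAffine {k : Type*} [DivisionRing k] {n : ℕ} (A : Set (Fin n → k)) : Prop :=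
  A.Nonempty ∧ ∃ S : AffineSubspace kᵐᵒᵖ (Fin n → k), (S : Set (Fin n → k)) = A

/-- The dimension of a left affine subspace `A`: the left dimension of its direction, the
left span of the differences of points of `A`. -/
noncomputable def leftDim {k : Type*} [DivisionRing k] {n : ℕ} (A : Set (Fin n → k)) : ℕ :=
  Module.finrank k (vectorSpan k A)

/-- The dimension of a right affine subspace `A`. -/
noncomputable def rightDim {k : Type*} [DivisionRing k] {n : ℕ} (A : Set (Fin n → k)) : ℕ :=
  Module.finrank kᵐᵒᵖ (vectorSpan kᵐᵒᵖ A)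

/-- A purely left line: a left affine line that is not a right affine subspace. -/
def IsPurelyLeftLine {k : Type*} [DivisionRing k] {n : ℕ} (L : Set (Fin n → k)) : Prop :=
  IsLeftAffine L ∧ ¬ IsRightAffine L ∧ leftDim L = 1

/-- A two-sided plane: both a left and a right affine subspace, of dimension 2
(the left and right dimensions of a two-sided affine subspace coincide). -/
def IsTwoSidedPlane {k : Type*} [DivisionRing k] {n : ℕ} (P : Set (Fin n → k)) : Prop :=
  IsLeftAffine P ∧ IsRightAffine P ∧ leftDim P = 2

/-- A left linear map `kⁿ → kⁿ` is defined over the centre of `k` if its matrix in the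
standard basis has entries in the centre. -/
def IsDefinedOverCenter {k : Type*} [DivisionRing k] {n : ℕ}
    (g : (Fin n → k) →ₗ[k] (Fin n → k)) : Prop :=
  ∀ i j : Fin n, g (Pi.single i 1) j ∈ Subring.center k

/-- `f(x) = σ(g(xa) + b)`, with `σ` an automorphism of `k` applied coordinatewise and `g` a left
linear map defined over the centre of `k`. -/
def HasStandardForm {k : Type*} [DivisionRing k] {n : ℕ}
    (f : (Fin n → k) → (Fin n → k)) : Prop :=
  ∃ (a : k) (b : Fin n → k) (σ : k ≃+* k) (g : (Fin n → k) →ₗ[k] (Fin n → k)),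
    IsDefinedOverCenter g ∧
      ∀ (x : Fin n → k) (j : Fin n), f x j = σ (g (fun i => x i * a) j + b j)

/-- `f` sends every left affine subspace to a left affine subspace of the same dimension. -/
def PreservesLeftAffine {k : Type*} [DivisionRing k] {n : ℕ}
    (f : (Fin n → k) → (Fin n → k)) : Prop :=
  ∀ A : Set (Fin n → k), IsLeftAffine A → IsLeftAffine (f '' A) ∧ leftDim (f '' A) = leftDim A

/-!
Injectivity makes dimensions strictly increase along the image of a complete flag of flats, so `f`
preserves dimension. If the image of a line is purely left, then every plane through the line has a
left image, since a right one would be the two-sided plane spanned by the image of the line. In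
dimension at least three, comparing the planes through two lines shows that a single purely left
image line makes the images of all lines left, and the fundamental theorem of affine geometry makes
`f` semilinear up to a translation. Testing `f` on the right lines spanned by `e i + μ • e j` with
`μ` not central shows that its matrix is central up to a common factor.

In dimension two only the images of purely left lines are known. The vectors spanning such lines
generate `k ^ 2`, and any two of them are joined by a chain whose consecutive members are linearly
independent with a sum of the same kind, which suffices for the fundamental theorem. Finally,
composing `f` with an anti-automorphism exchanges left and right in the image.
-/

open Module

section Flats

/-- The set `A` is a nonempty affine subspace of dimension `d` over `K`. Flats are encoded as sets
of points so that flats for different scalar actions on the same space can be compared. -/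
structure IsFlat (K : Type*) {V : Type*} [DivisionRing K] [AddCommGroup V] [Module K V]
    (d : ℕ) (A : Set V) : Prop where
  nonempty : A.Nonempty
  exists_coe_eq : ∃ S : AffineSubspace K V, (S : Set V) = A
  finrank_vectorSpan : finrank K (vectorSpan K A) = d

variable {K V : Type*} [DivisionRing K] [AddCommGroup V] [Module K V]

theorem isFlat_mk' (p : V) (S : Submodule K V) :
    IsFlat K (finrank K S) (AffineSubspace.mk' p S : Set V) :=
  ⟨⟨p, AffineSubspace.self_mem_mk' p S⟩, ⟨_, rfl⟩, by
    rw [← AffineSubspace.direction_eq_vectorSpan, AffineSubspace.direction_mk']⟩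

theorem isFlat_mk'_span_singleton (p : V) {x : V} (hx : x ≠ 0) :
    IsFlat K 1 (AffineSubspace.mk' p (K ∙ x) : Set V) :=
  finrank_span_singleton (K := K) hx ▸ isFlat_mk' p (K ∙ x)

theorem isFlat_singleton (p : V) : IsFlat K 0 ({p} : Set V) :=
  ⟨⟨p, rfl⟩, ⟨affineSpan K {p}, AffineSubspace.coe_affineSpan_singleton K V p⟩, by simp⟩

theorem isFlat_univ : IsFlat K (finrank K V) (Set.univ : Set V) :=
  ⟨⟨0, trivial⟩, ⟨⊤, AffineSubspace.top_coe K V V⟩, by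
    rw [← AffineSubspace.top_coe K V V, ← AffineSubspace.direction_eq_vectorSpan,
      AffineSubspace.direction_top, finrank_top]⟩

namespace IsFlat

variable {d e : ℕ} {A B l : Set V} {p q r x y : V}

theorem sub_mem_vectorSpan_iff (hA : IsFlat K d A) (hp : p ∈ A) :
    x - p ∈ vectorSpan K A ↔ x ∈ A := by
  obtain ⟨S, rfl⟩ := hA.exists_coe_eq
  exact S.vsub_right_mem_direction_iff_mem hp x

theorem coe_mk'_vectorSpan (hA : IsFlat K d A) (hp : p ∈ A) :
    (AffineSubspace.mk' p (vectorSpan K A) : Set V) = A :=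
  Set.ext fun _ => AffineSubspace.mem_mk'.trans (hA.sub_mem_vectorSpan_iff hp)

theorem add_sub_mem (hA : IsFlat K d A) (hp : p ∈ A) (hx : x ∈ A) (hy : y ∈ A) :
    x + (y - p) ∈ A :=
  (hA.sub_mem_vectorSpan_iff hx).1 <| by
    rw [add_sub_cancel_left]
    exact vsub_mem_vectorSpan K hy hp

theorem coe_affineSpan (hA : IsFlat K d A) : (affineSpan K A : Set V) = A := by
  obtain ⟨S, rfl⟩ := hA.exists_coe_eq
  rw [AffineSubspace.affineSpan_coe]

theorem affineSpan_subset (hA : IsFlat K d A) (h : B ⊆ A) : (affineSpan K B : Set V) ⊆ A :=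
  (SetLike.coe_subset_coe.2 (affineSpan_mono K h)).trans hA.coe_affineSpan.subset

theorem line_subset (hA : IsFlat K d A) (hx : x ∈ A) (hy : y ∈ A) :
    (line[K, x, y] : Set V) ⊆ A :=
  hA.affineSpan_subset (Set.pair_subset hx hy)

theorem mk'_vectorSpan_subset (hA : IsFlat K d A) (hlA : l ⊆ A) (hr : r ∈ A) :
    (AffineSubspace.mk' r (vectorSpan K l) : Set V) ⊆ A := fun _ hx =>
  (hA.sub_mem_vectorSpan_iff hr).1 (vectorSpan_mono K hlA (AffineSubspace.mem_mk'.1 hx))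

theorem notMem_of_mem_mk'_vectorSpan (hA : IsFlat K d A) (hlA : l ⊆ A) (hr : r ∉ A)
    (hx : x ∈ AffineSubspace.mk' r (vectorSpan K l)) : x ∉ A := fun hxA =>
  hr <| hA.mk'_vectorSpan_subset hlA hxA <| AffineSubspace.mem_mk'.2 <| by
    rw [vsub_eq_sub, ← neg_sub]
    exact neg_mem (AffineSubspace.mem_mk'.1 hx)

variable [FiniteDimensional K V]

theorem le_of_subset (hA : IsFlat K d A) (hB : IsFlat K e B)
    (h : A ⊆ B) : d ≤ e := by
  rw [← hA.finrank_vectorSpan, ← hB.finrank_vectorSpan]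
  exact Submodule.finrank_mono (vectorSpan_mono K h)

theorem eq_of_subset (hA : IsFlat K d A) (hB : IsFlat K d B)
    (h : A ⊆ B) : A = B := by
  obtain ⟨p, hp⟩ := hA.nonempty
  have hAB : vectorSpan K A = vectorSpan K B :=
    Submodule.eq_of_le_of_finrank_eq (vectorSpan_mono K h)
      (hA.finrank_vectorSpan.trans hB.finrank_vectorSpan.symm)
  rw [← hA.coe_mk'_vectorSpan hp, hAB, hB.coe_mk'_vectorSpan (h hp)]

theorem affineSpan_insert (hA : IsFlat K d A) (hq : q ∉ A) :
    IsFlat K (d + 1) (affineSpan K (insert q A) : Set V) := by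
  obtain ⟨p, hp⟩ := hA.nonempty
  have hqA : q - p ∉ vectorSpan K A := fun h => hq ((hA.sub_mem_vectorSpan_iff hp).1 h)
  refine ⟨⟨q, subset_affineSpan K _ (Set.mem_insert q A)⟩, ⟨_, rfl⟩, ?_⟩
  rw [← AffineSubspace.direction_eq_vectorSpan, ← hA.finrank_vectorSpan,
    ← Submodule.finrank_sup_span_singleton hqA]
  obtain ⟨S, rfl⟩ := hA.exists_coe_eq
  rw [AffineSubspace.direction_affineSpan_insert hp, sup_comm, vsub_eq_sub,
    AffineSubspace.direction_eq_vectorSpan]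

theorem exists_superset (hA : IsFlat K d A) (hq : q ∉ A) :
    ∃ B, IsFlat K (d + 1) B ∧ A ⊆ B ∧ q ∈ B :=
  have hsub : insert q A ⊆ (affineSpan K (insert q A) : Set V) := subset_affineSpan K _
  ⟨_, hA.affineSpan_insert hq, (Set.subset_insert q A).trans hsub, hsub (Set.mem_insert q A)⟩

theorem eq_of_subset_of_mem {C : Set V} (hA : IsFlat K d A) (hq : q ∉ A)
    (hB : IsFlat K (d + 1) B) (hC : IsFlat K (d + 1) C) (hAB : A ⊆ B) (hAC : A ⊆ C) (hqB : q ∈ B)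
    (hqC : q ∈ C) : B = C :=
  ((hA.affineSpan_insert hq).eq_of_subset hB
      (hB.affineSpan_subset (Set.insert_subset hqB hAB))).symm.trans
    ((hA.affineSpan_insert hq).eq_of_subset hC
      (hC.affineSpan_subset (Set.insert_subset hqC hAC)))

theorem exists_subset (hA : IsFlat K (d + 1) A) :
    ∃ B ⊂ A, IsFlat K d B := by
  obtain ⟨p, hp⟩ := hA.nonempty
  have hpos : 0 < finrank K (vectorSpan K A) := hA.finrank_vectorSpan ▸ d.succ_pos
  obtain ⟨x, hx⟩ := finrank_pos_iff_exists_ne_zero.1 hpos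
  obtain ⟨C, hC⟩ := Submodule.exists_isCompl (K ∙ x)
  have hCd : finrank K (C.map (vectorSpan K A).subtype) = d := by
    have := Submodule.finrank_add_eq_of_isCompl hC
    rw [finrank_span_singleton hx, hA.finrank_vectorSpan] at this
    rw [Submodule.finrank_map_subtype_eq]
    omega
  have hB := isFlat_mk' p (C.map (vectorSpan K A).subtype)
  rw [hCd] at hB
  have hBA : (AffineSubspace.mk' p (C.map (vectorSpan K A).subtype) : Set V) ⊆ A := fun y hy =>
    (hA.sub_mem_vectorSpan_iff hp).1 (Submodule.map_subtype_le _ _ (AffineSubspace.mem_mk'.1 hy))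
  refine ⟨_, hBA.ssubset_of_ne fun h => ?_, hB⟩
  rw [h] at hB
  exact d.succ_ne_self (hA.finrank_vectorSpan.symm.trans hB.finrank_vectorSpan)

theorem exists_notMem (hA : IsFlat K d A) (hd : d < finrank K V) :
    ∃ x, x ∉ A := by
  by_contra! h
  exact hd.not_ge (isFlat_univ.le_of_subset hA fun x _ => h x)

end IsFlat

variable [FiniteDimensional K V]

theorem isFlat_line {x y : V} (hxy : x ≠ y) : IsFlat K 1 (line[K, x, y] : Set V) := by
  rw [Set.pair_comm]
  exact (isFlat_singleton x).affineSpan_insert hxy.symm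

namespace IsFlat

variable {l m : Set V} {x y : V}

theorem line_eq (hl : IsFlat K 1 l) (hxy : x ≠ y) (hx : x ∈ l) (hy : y ∈ l) :
    (line[K, x, y] : Set V) = l :=
  (isFlat_line hxy).eq_of_subset hl (hl.line_subset hx hy)

theorem eq_of_mem_of_mem (hl : IsFlat K 1 l) (hm : IsFlat K 1 m) (hxy : x ≠ y) (hxl : x ∈ l)
    (hyl : y ∈ l) (hxm : x ∈ m) (hym : y ∈ m) : l = m :=
  (hl.line_eq hxy hxl hyl).symm.trans (hm.line_eq hxy hxm hym)

theorem exists_ne (hl : IsFlat K 1 l) (x : V) : ∃ y ∈ l, y ≠ x := by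
  by_contra! h
  exact absurd (hl.le_of_subset (isFlat_singleton x) h) (by decide)

end IsFlat

end Flats

section TwoStructures

/-- A space with commuting actions of `K` and `K'` such that the two dimensions of a subset that is
a subspace for both actions coincide, as they do for the two-sided subspaces of `kⁿ`. -/
class EquidimBimodule (K K' V : Type*) [DivisionRing K] [DivisionRing K'] [AddCommGroup V]
    [Module K V] [Module K' V] : Prop extends SMulCommClass K K' V where
  finrank_eq : ∀ (S : Submodule K V) (S' : Submodule K' V),
    (S : Set V) = S' → finrank K S = finrank K' S'

/-- A flat of dimension `d` for at least one of two scalar actions. -/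
def IsMixedFlat (K K' : Type*) {V : Type*} [DivisionRing K] [DivisionRing K'] [AddCommGroup V]
    [Module K V] [Module K' V] (d : ℕ) (A : Set V) : Prop :=
  IsFlat K d A ∨ IsFlat K' d A

/-- A flat of dimension `d` for `K` that is not one for `K'`. -/
def IsPurelyFlat (K K' : Type*) {V : Type*} [DivisionRing K] [DivisionRing K'] [AddCommGroup V]
    [Module K V] [Module K' V] (d : ℕ) (A : Set V) : Prop :=
  IsFlat K d A ∧ ¬ IsFlat K' d A

variable {K K' V : Type*} [DivisionRing K] [DivisionRing K'] [AddCommGroup V]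
  [Module K V] [Module K' V] {d e : ℕ} {A B N : Set V}

theorem EquidimBimodule.symm (h : EquidimBimodule K K' V) : EquidimBimodule K' K V where
  toSMulCommClass := SMulCommClass.symm K K' V
  finrank_eq S S' hS := (h.finrank_eq S' S hS.symm).symm

theorem exists_submodule_coe_eq_span [SMulCommClass K K' V] (S : Submodule K V) :
    ∃ U : Submodule K V, (U : Set V) = Submodule.span K' (S : Set V) := by
  have hsmul (c : K) {x : V} (hx : x ∈ Submodule.span K' (S : Set V)) :
      c • x ∈ Submodule.span K' (S : Set V) :=
    (Submodule.map_span_le (DistribSMul.toLinearMap K' V c) S _).2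
      (fun y hy => Submodule.subset_span (S.smul_mem c hy)) (Submodule.mem_map_of_mem hx)
  exact ⟨{ (Submodule.span K' (S : Set V)).toAddSubmonoid with smul_mem' := fun c _ => hsmul c },
    rfl⟩

theorem IsFlat.vectorSpan_eq_span (hA : IsFlat K d A) :
    vectorSpan K' A = Submodule.span K' (vectorSpan K A : Set V) := by
  obtain ⟨p, hp⟩ := hA.nonempty
  rw [vectorSpan_eq_span_vsub_set_right K' hp]
  congr 1
  ext x
  constructor
  · rintro ⟨y, hy, rfl⟩
    exact vsub_mem_vectorSpan K hy hp
  · exact fun hx => ⟨x + p, (hA.sub_mem_vectorSpan_iff hp).1 (by rwa [add_sub_cancel_right]),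
      add_sub_cancel_right x p⟩

theorem IsFlat.exists_isFlat_affineSpan [EquidimBimodule K K' V] (hA : IsFlat K d A) :
    ∃ e, IsFlat K e (affineSpan K' A : Set V) ∧ IsFlat K' e (affineSpan K' A : Set V) := by
  obtain ⟨p, hp⟩ := hA.nonempty
  obtain ⟨U, hU⟩ := exists_submodule_coe_eq_span (K' := K') (vectorSpan K A)
  rw [← hA.vectorSpan_eq_span] at hU
  have hspan : AffineSubspace.mk' p (vectorSpan K' A) = affineSpan K' A := by
    rw [← direction_affineSpan]
    exact AffineSubspace.mk'_eq (mem_affineSpan K' hp)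
  have hcoe : (AffineSubspace.mk' p U : Set V) = AffineSubspace.mk' p (vectorSpan K' A) :=
    congrArg (fun S : Set V => {x | x - p ∈ S}) hU
  refine ⟨finrank K U, ?_, ?_⟩ <;> rw [← hspan]
  · exact hcoe ▸ isFlat_mk' p U
  · exact EquidimBimodule.finrank_eq U _ hU ▸ isFlat_mk' p (vectorSpan K' A)

variable [EquidimBimodule K K' V] [FiniteDimensional K V] [FiniteDimensional K' V]

theorem IsFlat.le_of_subset' (hA : IsFlat K d A) (hB : IsFlat K' e B) (h : A ⊆ B) : d ≤ e := by
  obtain ⟨m, hm, hm'⟩ := hA.exists_isFlat_affineSpan (K' := K')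
  exact (hA.le_of_subset hm (subset_affineSpan K' A)).trans
    (hm'.le_of_subset hB (hB.affineSpan_subset h))

theorem IsFlat.eq_of_subset' (hA : IsFlat K d A) (hB : IsFlat K' d B) (h : A ⊆ B) : A = B := by
  obtain ⟨m, hm, hm'⟩ := hA.exists_isFlat_affineSpan (K' := K')
  obtain rfl : d = m := (hA.le_of_subset hm (subset_affineSpan K' A)).antisymm
    (hm'.le_of_subset hB (hB.affineSpan_subset h))
  exact (hA.eq_of_subset hm (subset_affineSpan K' A)).trans
    (hm'.eq_of_subset hB (hB.affineSpan_subset h))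

theorem IsMixedFlat.le_of_subset (hA : IsMixedFlat K K' d A) (hB : IsMixedFlat K K' e B)
    (h : A ⊆ B) : d ≤ e := by
  have : EquidimBimodule K' K V := .symm ‹_›
  rcases hA with hA | hA <;> rcases hB with hB | hB
  exacts [hA.le_of_subset hB h, hA.le_of_subset' hB h, hA.le_of_subset' hB h, hA.le_of_subset hB h]

theorem IsMixedFlat.eq_of_subset (hA : IsMixedFlat K K' d A) (hB : IsMixedFlat K K' d B)
    (h : A ⊆ B) : A = B := by
  have : EquidimBimodule K' K V := .symm ‹_›
  rcases hA with hA | hA <;> rcases hB with hB | hB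
  exacts [hA.eq_of_subset hB h, hA.eq_of_subset' hB h, hA.eq_of_subset' hB h, hA.eq_of_subset hB h]

theorem IsMixedFlat.lt_of_ssubset (hA : IsMixedFlat K K' d A) (hB : IsMixedFlat K K' e B)
    (h : A ⊂ B) : d < e :=
  (hA.le_of_subset hB h.subset).lt_of_ne fun hde => h.ne (hA.eq_of_subset (hde ▸ hB) h.subset)

theorem IsPurelyFlat.affineSpan_eq (hN : IsPurelyFlat K K' d N) (hB : IsFlat K' (d + 1) B)
    (h : N ⊆ B) : (affineSpan K' N : Set V) = B ∧ IsFlat K (d + 1) B := by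
  obtain ⟨e, he, he'⟩ := hN.1.exists_isFlat_affineSpan (K' := K')
  have hlt : d < e := by
    refine (hN.1.le_of_subset he (subset_affineSpan K' N)).lt_of_ne ?_
    rintro rfl
    exact hN.2 (hN.1.eq_of_subset he (subset_affineSpan K' N) ▸ he')
  have hsub := hB.affineSpan_subset h
  obtain rfl : e = d + 1 := (he'.le_of_subset hB hsub).antisymm hlt
  have heq := he'.eq_of_subset hB hsub
  exact ⟨heq, heq ▸ he⟩

theorem IsFlat.of_two_lines (hB : IsFlat K 2 B) {l m : Set V} {q : V} (hl : IsFlat K' 1 l)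
    (hm : IsFlat K' 1 m) (hlm : l ≠ m) (hql : q ∈ l) (hqm : q ∈ m) (hlB : l ⊆ B) (hmB : m ⊆ B) :
    IsFlat K' 2 B := by
  have : EquidimBimodule K' K V := .symm ‹_›
  obtain ⟨y, hym, hyq⟩ := hm.exists_ne q
  have hyl : y ∉ l := fun hyl => hlm (hl.eq_of_mem_of_mem hm hyq hyl hql hym hqm)
  have hC := hl.affineSpan_insert hyl
  suffices hsub : (affineSpan K' (insert y l) : Set V) ⊆ B from hC.eq_of_subset' hB hsub ▸ hC
  intro x hx
  obtain ⟨S, rfl⟩ := hl.exists_coe_eq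
  obtain ⟨c, a, ha, rfl⟩ := (AffineSubspace.mem_affineSpan_insert_iff hql y x).1 hx
  have hc : c • (y - q) + q ∈ m :=
    hm.line_subset hqm hym (AffineMap.lineMap_mem_affineSpan_pair c q y)
  simpa [add_comm] using hB.add_sub_mem (hlB hql) (hlB ha) (hmB hc)

end TwoStructures

section Dimension

variable {K L L' V W : Type*} [DivisionRing K] [DivisionRing L] [DivisionRing L']
  [AddCommGroup V] [AddCommGroup W] [Module K V] [Module L W] [Module L' W]
  [FiniteDimensional K V] [FiniteDimensional L W] [FiniteDimensional L' W]
  [EquidimBimodule L L' W] {f : V → W} {d e : ℕ} {A : Set V}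

theorem le_finrank_image (hinj : Function.Injective f)
    (hf : ∀ (d : ℕ) (A : Set V), IsFlat K d A → ∃ e, IsMixedFlat L L' e (f '' A))
    (hA : IsFlat K d A) (he : IsMixedFlat L L' e (f '' A)) : d ≤ e := by
  induction d generalizing A e with
  | zero => exact e.zero_le
  | succ d ih =>
    obtain ⟨B, hBA, hB⟩ := hA.exists_subset
    obtain ⟨m, hm⟩ := hf d B hB
    exact (ih hB hm).trans_lt (hm.lt_of_ssubset he (hinj.image_strictMono hBA))

theorem finrank_image_le (hinj : Function.Injective f)
    (hf : ∀ (d : ℕ) (A : Set V), IsFlat K d A → ∃ e, IsMixedFlat L L' e (f '' A))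
    (hVW : finrank K V = finrank L W) (hA : IsFlat K d A) (he : IsMixedFlat L L' e (f '' A)) :
    e ≤ d := by
  obtain ⟨c, hc⟩ := Nat.exists_eq_add_of_le (hA.le_of_subset isFlat_univ (Set.subset_univ A))
  induction c generalizing A d e with
  | zero =>
    have := he.le_of_subset (.inl isFlat_univ) (Set.subset_univ _)
    omega
  | succ c ih =>
    obtain ⟨q, hq⟩ := hA.exists_notMem (by omega)
    have hB := hA.affineSpan_insert hq
    obtain ⟨m, hm⟩ := hf _ _ hB
    have hAB : A ⊂ affineSpan K (insert q A) :=
      (Set.ssubset_insert hq).trans_subset (subset_affineSpan K _)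
    have := he.lt_of_ssubset hm (hinj.image_strictMono hAB)
    have := ih hB hm (by omega)
    omega

theorem IsFlat.isMixedFlat_image (hinj : Function.Injective f)
    (hf : ∀ (d : ℕ) (A : Set V), IsFlat K d A → ∃ e, IsMixedFlat L L' e (f '' A))
    (hVW : finrank K V = finrank L W) (hA : IsFlat K d A) : IsMixedFlat L L' d (f '' A) := by
  obtain ⟨e, he⟩ := hf d A hA
  obtain rfl := (le_finrank_image hinj hf hA he).antisymm (finrank_image_le hinj hf hVW hA he)
  exact he

theorem surjective_of_isMixedFlat_image (hinj : Function.Injective f)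
    (hf : ∀ (d : ℕ) (A : Set V), IsFlat K d A → ∃ e, IsMixedFlat L L' e (f '' A))
    (hVW : finrank K V = finrank L W) : Function.Surjective f := by
  have himage := (isFlat_univ (K := K)).isMixedFlat_image hinj hf hVW
  rw [hVW, Set.image_univ] at himage
  exact Set.range_eq_univ.1 (himage.eq_of_subset (.inl isFlat_univ) (Set.subset_univ _))

end Dimension

section Dichotomy

/-- An injective map that sends every `K`-flat to a flat of the same dimension for at least one of
the two scalar actions on the target. -/
structure IsFlatEmbedding (K L L' : Type*) {V W : Type*} [DivisionRing K] [DivisionRing L]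
    [DivisionRing L'] [AddCommGroup V] [AddCommGroup W] [Module K V] [Module L W] [Module L' W]
    (f : V → W) : Prop where
  injective : Function.Injective f
  isMixedFlat_image : ∀ {d : ℕ} {A : Set V}, IsFlat K d A → IsMixedFlat L L' d (f '' A)

namespace IsFlatEmbedding

variable {K L L' V W : Type*} [DivisionRing K] [DivisionRing L] [DivisionRing L']
  [AddCommGroup V] [AddCommGroup W] [Module K V] [Module L W] [Module L' W]
  {f : V → W} {l m A B : Set V} {p q : V}

theorem symm (hf : IsFlatEmbedding K L L' f) : IsFlatEmbedding K L' L f :=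
  ⟨hf.injective, fun hA => (hf.isMixedFlat_image hA).symm⟩

theorem isPurelyFlat_image (hf : IsFlatEmbedding K L L' f) (hl : IsFlat K 1 l)
    (hl' : ¬ IsFlat L' 1 (f '' l)) : IsPurelyFlat L L' 1 (f '' l) :=
  ⟨(hf.isMixedFlat_image hl).resolve_right hl', hl'⟩

variable [FiniteDimensional L W] [FiniteDimensional L' W] [EquidimBimodule L L' W]

theorem isFlat_image_plane (hf : IsFlatEmbedding K L L' f)
    (hl : IsPurelyFlat L L' 1 (f '' l)) (hA : IsFlat K 2 A) (hlA : l ⊆ A) :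
    IsFlat L 2 (f '' A) :=
  (hf.isMixedFlat_image hA).elim id fun h => (hl.affineSpan_eq h (Set.image_mono hlA)).2

theorem isFlat_image_line (hf : IsFlatEmbedding K L L' f) (hA : IsFlat K 2 A)
    (hA' : ¬ IsFlat L 2 (f '' A)) (hm : IsFlat K 1 m) (hmA : m ⊆ A) : IsFlat L' 1 (f '' m) :=
  by_contra fun hm' => hA' (hf.isFlat_image_plane (hf.isPurelyFlat_image hm hm') hA hmA)

theorem plane_unique (hf : IsFlatEmbedding K L L' f) (hl : IsPurelyFlat L L' 1 (f '' l))
    (hlA : l ⊆ A) (hlB : l ⊆ B) (hA : IsFlat L' 2 (f '' A)) (hB : IsFlat L' 2 (f '' B)) :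
    A = B :=
  hf.injective.image_injective <| (hl.affineSpan_eq hA (Set.image_mono hlA)).1.symm.trans
    (hl.affineSpan_eq hB (Set.image_mono hlB)).1

variable [FiniteDimensional K V]

theorem isFlat_image_plane_of_pencil (hf : IsFlatEmbedding K L L' f) (hA : IsFlat K 2 A)
    (hLA : IsFlat L 2 (f '' A)) (hl : IsFlat K 1 l) (hlA : l ⊆ A) (hqA : q ∈ A) (hql : q ∉ l)
    (h : ∀ p ∈ l, IsFlat L' 1 (f '' line[K, p, q])) : IsFlat L' 2 (f '' A) := by
  obtain ⟨x, hx⟩ := hl.nonempty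
  obtain ⟨y, hy, hyx⟩ := hl.exists_ne x
  have hne (p) (hp : p ∈ l) : p ≠ q := fun h => hql (h ▸ hp)
  have hq (p) : q ∈ (line[K, p, q] : Set V) := right_mem_affineSpan_pair K p q
  have hp (p) : p ∈ (line[K, p, q] : Set V) := left_mem_affineSpan_pair K p q
  have hsub (p) (hp : p ∈ l) : f '' line[K, p, q] ⊆ f '' A :=
    Set.image_mono (hA.line_subset (hlA hp) hqA)
  refine hLA.of_two_lines (h x hx) (h y hy) (fun heq => hql ?_) (Set.mem_image_of_mem f (hq x))
    (Set.mem_image_of_mem f (hq y)) (hsub x hx) (hsub y hy)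
  have hyx' : y ∈ (line[K, x, q] : Set V) := hf.injective.image_injective heq ▸ hp y
  exact (isFlat_line (hne x hx)).eq_of_mem_of_mem hl hyx hyx' (hp x) hy hx ▸ hq x

theorem not_isPurelyFlat_of_mem_of_mem (hf : IsFlatEmbedding K L L' f) (h3 : 2 < finrank K V)
    (hl : IsFlat K 1 l) (hm : IsFlat K 1 m) (hpl : p ∈ l) (hpm : p ∈ m)
    (hfl : IsPurelyFlat L L' 1 (f '' l)) : ¬ IsPurelyFlat L' L 1 (f '' m) := by
  intro hfm
  have : EquidimBimodule L' L W := .symm ‹_›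
  obtain ⟨q, hqm, hqp⟩ := hm.exists_ne p
  have hql : q ∉ l := fun hql => hfl.2 (hl.eq_of_mem_of_mem hm hqp hql hpl hqm hpm ▸ hfm.1)
  obtain ⟨A₀, hA₀, hlA₀, hqA₀⟩ := hl.exists_superset hql
  have hmA₀ : m ⊆ A₀ := hm.line_eq hqp hqm hpm ▸ hA₀.line_subset hqA₀ (hlA₀ hpl)
  have hLA₀ := hf.isFlat_image_plane hfl hA₀ hlA₀
  have hL'A₀ := hf.symm.isFlat_image_plane hfm hA₀ hmA₀
  obtain ⟨r, hr⟩ := hA₀.exists_notMem h3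
  obtain ⟨A, hA, hlA, hrA⟩ := hl.exists_superset fun h => hr (hlA₀ h)
  -- The lines joining `p` to a parallel `l'` of `l` outside `A₀` are all sent to `L'`-lines.
  let l' : Set V := ↑(AffineSubspace.mk' r (vectorSpan K l))
  have hl' : IsFlat K 1 l' := hl.finrank_vectorSpan ▸ isFlat_mk' r _
  have hl'A₀ (s) (hs : s ∈ l') : s ∉ A₀ := hA₀.notMem_of_mem_mk'_vectorSpan hlA₀ hr hs
  have hpencil (s) (hs : s ∈ l') : IsFlat L' 1 (f '' line[K, s, p]) := by
    obtain ⟨B, hB, hmB, hsB⟩ := hm.exists_superset fun h => hl'A₀ s hs (hmA₀ h)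
    have hLB : ¬ IsFlat L 2 (f '' B) := fun hLB =>
      hl'A₀ s hs (hf.symm.plane_unique hfm hmB hmA₀ hLB hLA₀ ▸ hsB)
    have hsp : s ≠ p := fun h => hl'A₀ s hs (h ▸ hlA₀ hpl)
    exact hf.isFlat_image_line hB hLB (isFlat_line hsp) (hB.line_subset hsB (hmB hpm))
  have hL'A := hf.isFlat_image_plane_of_pencil hA (hf.isFlat_image_plane hfl hA hlA) hl'
    (hA.mk'_vectorSpan_subset hlA hrA) (hlA hpl) (fun h => hl'A₀ p h (hlA₀ hpl)) hpencil
  exact hr (hf.plane_unique hfl hlA hlA₀ hL'A hL'A₀ ▸ hrA)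

theorem exists_plane_of_isPurelyFlat (hf : IsFlatEmbedding K L L' f) (h3 : 2 < finrank K V)
    (hl : IsFlat K 1 l) (hm : IsFlat K 1 m) (hfl : IsPurelyFlat L L' 1 (f '' l))
    (hfm : IsPurelyFlat L' L 1 (f '' m)) :
    ∃ A, IsFlat K 2 A ∧ l ⊆ A ∧ m ⊆ A ∧ IsFlat L' 2 (f '' A) := by
  have hplane (x) (hx : x ∈ m) :
      ∃ A, IsFlat K 2 A ∧ l ⊆ A ∧ x ∈ A ∧ IsFlat L' 2 (f '' A) := by
    have hxl : x ∉ l := fun hxl => hf.not_isPurelyFlat_of_mem_of_mem h3 hl hm hxl hx hfl hfm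
    obtain ⟨A, hA, hlA, hxA⟩ := hl.exists_superset hxl
    refine ⟨A, hA, hlA, hxA, hf.isFlat_image_plane_of_pencil hA
      (hf.isFlat_image_plane hfl hA hlA) hl hlA hxA hxl fun p hp => by_contra fun ht => ?_⟩
    have ht' : IsFlat K 1 (line[K, p, x] : Set V) := isFlat_line fun h => hxl (h ▸ hp)
    exact hf.not_isPurelyFlat_of_mem_of_mem h3 ht' hm (right_mem_affineSpan_pair K p x) hx
      (hf.isPurelyFlat_image ht' ht) hfm
  obtain ⟨q, hq⟩ := hm.nonempty
  obtain ⟨A, hA, hlA, -, hL'A⟩ := hplane q hq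
  refine ⟨A, hA, hlA, fun x hx => ?_, hL'A⟩
  obtain ⟨B, -, hlB, hxB, hL'B⟩ := hplane x hx
  exact hf.plane_unique hfl hlB hlA hL'B hL'A ▸ hxB

theorem isFlat_image_line_of_isPurelyFlat (hf : IsFlatEmbedding K L L' f)
    (h3 : 2 < finrank K V) (hl : IsFlat K 1 l) (hfl : IsPurelyFlat L L' 1 (f '' l))
    (hm : IsFlat K 1 m) : IsFlat L 1 (f '' m) := by
  by_contra hfm
  replace hfm := hf.symm.isPurelyFlat_image hm hfm
  obtain ⟨A₀, hA₀, hlA₀, hmA₀, hL'A₀⟩ := hf.exists_plane_of_isPurelyFlat h3 hl hm hfl hfm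
  obtain ⟨r, hr⟩ := hA₀.exists_notMem h3
  have hrl : r ∉ l := fun h => hr (hlA₀ h)
  obtain ⟨A, hA, hlA, hrA⟩ := hl.exists_superset hrl
  obtain ⟨p, hp, hfp⟩ : ∃ p ∈ l, ¬ IsFlat L' 1 (f '' line[K, p, r]) := by
    by_contra! h
    have hL'A := hf.isFlat_image_plane_of_pencil hA (hf.isFlat_image_plane hfl hA hlA) hl hlA
      hrA hrl h
    exact hr (hf.plane_unique hfl hlA hlA₀ hL'A hL'A₀ ▸ hrA)
  have ht : IsFlat K 1 (line[K, p, r] : Set V) := isFlat_line fun h => hrl (h ▸ hp)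
  obtain ⟨B, hB, htB, hmB, -⟩ :=
    hf.exists_plane_of_isPurelyFlat h3 ht hm (hf.isPurelyFlat_image ht hfp) hfm
  have hpm : p ∉ m := fun hpm => hf.not_isPurelyFlat_of_mem_of_mem h3 hl hm hp hpm hfl hfm
  have hBA₀ : B = A₀ := hm.eq_of_subset_of_mem hpm hB hA₀ hmB hmA₀
    (htB (left_mem_affineSpan_pair K p r)) (hlA₀ hp)
  exact hr (hBA₀ ▸ htB (right_mem_affineSpan_pair K p r))

theorem isFlat_image_plane_of_forall_line (hf : IsFlatEmbedding K L L' f)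
    (hline : ∀ l : Set V, IsFlat K 1 l → IsFlat L 1 (f '' l)) (hA : IsFlat K 2 A) :
    IsFlat L 2 (f '' A) := by
  have : EquidimBimodule L' L W := .symm ‹_›
  refine (hf.isMixedFlat_image hA).elim id fun hL'A => ?_
  obtain ⟨l, hlA, hl⟩ := hA.exists_subset
  obtain ⟨q, hqA, hql⟩ := Set.exists_of_ssubset hlA
  exact hf.symm.isFlat_image_plane_of_pencil hA hL'A hl hlA.subset hqA hql fun p hp =>
    hline _ (isFlat_line fun h => hql (h ▸ hp))

end IsFlatEmbedding

end Dichotomy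

section Fundamental

section Parallelism

variable {K V : Type*} [DivisionRing K] [AddCommGroup V] [Module K V]

theorem notMem_span_singleton_symm {x y : V} (hx : x ≠ 0) (h : y ∉ K ∙ x) : x ∉ K ∙ y := by
  intro hxy
  obtain ⟨c, rfl⟩ := Submodule.mem_span_singleton.1 hxy
  have hc : c ≠ 0 := fun hc => hx (by rw [hc, zero_smul])
  exact h (Submodule.mem_span_singleton.2 ⟨c⁻¹, inv_smul_smul₀ hc y⟩)

namespace IsFlat

variable {d e : ℕ} {A B l m : Set V} {p : V}

theorem disjoint_vectorSpan (hA : IsFlat K d A) (hB : IsFlat K e B) (hpA : p ∈ A) (hpB : p ∈ B)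
    (h : A ∩ B ⊆ {p}) : Disjoint (vectorSpan K A) (vectorSpan K B) := by
  refine Submodule.disjoint_def.2 fun x hxA hxB => ?_
  rw [← add_sub_cancel_right x p] at hxA hxB
  exact add_eq_right.1 (h ⟨(hA.sub_mem_vectorSpan_iff hpA).1 hxA,
    (hB.sub_mem_vectorSpan_iff hpB).1 hxB⟩)

theorem vectorSpan_eq_of_disjoint [FiniteDimensional K V] (hl : IsFlat K 1 l) (hm : IsFlat K 1 m)
    (hB : IsFlat K 2 B) (hlB : l ⊆ B) (hmB : m ⊆ B) (hlm : Disjoint l m) :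
    vectorSpan K l = vectorSpan K m := by
  refine (Submodule.eq_of_le_of_finrank_eq (fun v hv => ?_)
    (hm.finrank_vectorSpan.trans hl.finrank_vectorSpan.symm)).symm
  by_contra hvl
  have hsup : vectorSpan K l ⊔ K ∙ v = vectorSpan K B :=
    Submodule.eq_of_le_of_finrank_eq (sup_le (vectorSpan_mono K hlB)
      ((Submodule.span_singleton_le_iff_mem v _).2 (vectorSpan_mono K hmB hv))) <| by
        rw [Submodule.finrank_sup_span_singleton hvl, hl.finrank_vectorSpan,
          hB.finrank_vectorSpan]
  obtain ⟨p, hp⟩ := hl.nonempty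
  obtain ⟨q, hq⟩ := hm.nonempty
  have hqp : q - p ∈ vectorSpan K l ⊔ K ∙ v := hsup ▸ vsub_mem_vectorSpan K (hmB hq) (hlB hp)
  obtain ⟨a, ha, b, hb, hab⟩ := Submodule.mem_sup.1 hqp
  obtain ⟨c, rfl⟩ := Submodule.mem_span_singleton.1 hb
  have hal : a + p ∈ l := (hl.sub_mem_vectorSpan_iff hp).1 (by rwa [add_sub_cancel_right])
  have ham : a + p ∈ m := (hm.sub_mem_vectorSpan_iff hq).1 <| by
    have : a + p - q = -(c • v) := by rw [eq_sub_of_add_eq hab]; abel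
    exact this ▸ neg_mem (Submodule.smul_mem _ c hv)
  exact Set.disjoint_left.1 hlm hal ham

end IsFlat

end Parallelism

variable {K L V W : Type*} [DivisionRing K] [DivisionRing L]
  [AddCommGroup V] [AddCommGroup W] [Module K V] [Module L W]

/-- The injective map `f` sends each line whose direction is spanned by a vector of `G` to a line,
and each plane whose direction is spanned by two vectors of `G` into a plane. -/
structure MapsLinesAlong (K L : Type*) {V W : Type*} [DivisionRing K] [DivisionRing L]
    [AddCommGroup V] [AddCommGroup W] [Module K V] [Module L W] (f : V → W) (G : Set V) :
    Prop where
  injective : Function.Injective f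
  isFlat_line : ∀ x ∈ G, ∀ p : V, IsFlat L 1 (f '' AffineSubspace.mk' p (K ∙ x))
  exists_plane : ∀ x ∈ G, ∀ y ∈ G, y ∉ K ∙ x → ∀ p : V,
    ∃ B, IsFlat L 2 B ∧ f '' AffineSubspace.mk' p (Submodule.span K {x, y}) ⊆ B

/-- Two independent vectors of `G` whose sum lies in `G`. -/
def SumAdj (K : Type*) {V : Type*} [DivisionRing K] [AddCommGroup V] [Module K V] (G : Set V)
    (x y : V) : Prop :=
  x ∈ G ∧ y ∈ G ∧ y ∉ K ∙ x ∧ x + y ∈ G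

/-- A set of directions large enough for the fundamental theorem of affine geometry to hold for
maps that are only known to preserve the lines along these directions. -/
structure IsAmple (K : Type*) {V : Type*} [DivisionRing K] [AddCommGroup V] [Module K V]
    (G : Set V) : Prop where
  nonempty : G.Nonempty
  closure_sdiff : ∀ y ∈ G, AddSubgroup.closure (G \ (K ∙ y : Submodule K V)) = ⊤
  eqvGen : ∀ x ∈ G, ∀ y ∈ G, Relation.EqvGen (SumAdj K G) x y

/-- The map `f` is a `σ`-semilinear map followed by a translation. -/
def IsSemiaffine (σ : K ≃+* L) (f : V → W) : Prop :=
  ∃ g : V →ₛₗ[(σ : K →+* L)] W, ∀ x, f x = g x + f 0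

variable {f : V → W} {G : Set V}

theorem exists_ringEquiv_of_map_smul {g : V →+ W} (hg : Function.Injective g) {σ : K → L}
    (hσ : ∀ c x, g (c • x) = σ c • g x) {x : V} (hx : x ≠ 0)
    (hsurj : ∀ d : L, ∃ c : K, g (c • x) = d • g x) : ∃ τ : K ≃+* L, ∀ c, τ c = σ c := by
  have hgx : g x ≠ 0 := (map_ne_zero_iff g hg).2 hx
  have hinj := smul_left_injective L hgx
  let τ : K →+* L :=
    { toFun := σ
      map_one' := hinj (by simp only [← hσ, one_smul])
      map_mul' := fun a b => hinj (by simp only [← hσ, mul_smul])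
      map_zero' := hinj (by simp only [← hσ, zero_smul, map_zero])
      map_add' := fun a b => hinj (by simp only [add_smul, ← hσ, map_add]) }
  have hτ : Function.Surjective τ := fun d => by
    obtain ⟨c, hc⟩ := hsurj d
    exact ⟨c, hinj ((hσ c x).symm.trans hc)⟩
  exact ⟨RingEquiv.ofBijective τ ⟨τ.injective, hτ⟩, fun _ => rfl⟩

theorem IsAmple.closure_eq_top (hG : IsAmple K G) : AddSubgroup.closure G = ⊤ := by
  obtain ⟨y, hy⟩ := hG.nonempty
  exact top_unique (hG.closure_sdiff y hy ▸ AddSubgroup.closure_mono Set.sdiff_subset)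

namespace MapsLinesAlong

variable {x y : V}

theorem ne_zero (hf : MapsLinesAlong K L f G) (hx : x ∈ G) : x ≠ 0 := by
  rintro rfl
  have hline := (hf.isFlat_line 0 hx 0).finrank_vectorSpan
  have hpoint : (AffineSubspace.mk' (0 : V) (K ∙ (0 : V)) : Set V) = {0} := by
    ext
    simp [AffineSubspace.mem_mk']
  rw [hpoint, Set.image_singleton, vectorSpan_singleton, finrank_bot] at hline
  exact zero_ne_one hline

theorem sub_mem_vectorSpan (p x : V) :
    f (p + x) - f p ∈ vectorSpan L (f '' AffineSubspace.mk' p (K ∙ x)) :=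
  vsub_mem_vectorSpan L
    (Set.mem_image_of_mem f (by simp [AffineSubspace.mem_mk', Submodule.mem_span_singleton_self]))
    (Set.mem_image_of_mem f (AffineSubspace.self_mem_mk' p _))

theorem disjoint_vectorSpan (hf : MapsLinesAlong K L f G) (hx : x ∈ G) (hy : y ∈ G)
    (hxy : y ∉ K ∙ x) (p : V) :
    Disjoint (vectorSpan L (f '' AffineSubspace.mk' p (K ∙ x)))
      (vectorSpan L (f '' AffineSubspace.mk' p (K ∙ y))) := by
  have hp (x : V) : f p ∈ f '' AffineSubspace.mk' p (K ∙ x) :=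
    Set.mem_image_of_mem f (AffineSubspace.self_mem_mk' p _)
  refine (hf.isFlat_line x hx p).disjoint_vectorSpan (hf.isFlat_line y hy p) (hp x) (hp y) ?_
  rw [← Set.image_inter hf.injective, ← Set.image_singleton]
  refine Set.image_mono fun z hz => sub_eq_zero.1 ?_
  exact Submodule.disjoint_def.1 ((Submodule.disjoint_span_singleton' (hf.ne_zero hy)).2 hxy)
    (z - p) (AffineSubspace.mem_mk'.1 hz.1) (AffineSubspace.mem_mk'.1 hz.2)

variable [FiniteDimensional L W]

theorem vectorSpan_add_eq (hf : MapsLinesAlong K L f G) (hx : x ∈ G) (hy : y ∈ G)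
    (hxy : y ∉ K ∙ x) (p : V) :
    vectorSpan L (f '' AffineSubspace.mk' (p + y) (K ∙ x)) =
      vectorSpan L (f '' AffineSubspace.mk' p (K ∙ x)) := by
  obtain ⟨B, hB, hfB⟩ := hf.exists_plane x hx y hy hxy p
  have hle : K ∙ x ≤ Submodule.span K {x, y} := Submodule.span_mono (by simp)
  have hyS : y ∈ Submodule.span K {x, y} := Submodule.subset_span (by simp)
  refine (hf.isFlat_line x hx _).vectorSpan_eq_of_disjoint (hf.isFlat_line x hx p) hB
    ((Set.image_mono fun z hz => ?_).trans hfB) ((Set.image_mono fun z hz => ?_).trans hfB)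
    ((Set.disjoint_image_iff hf.injective).2 (Set.disjoint_left.2 fun z hz hz' => hxy ?_))
  · have hzp : z - p = z - (p + y) + y := by abel
    rw [SetLike.mem_coe, AffineSubspace.mem_mk', vsub_eq_sub, hzp]
    exact add_mem (hle (AffineSubspace.mem_mk'.1 hz)) hyS
  · exact AffineSubspace.mem_mk'.2 (hle (AffineSubspace.mem_mk'.1 hz))
  · have hy' : y = (z - p) - (z - (p + y)) := by abel
    exact hy' ▸ sub_mem (AffineSubspace.mem_mk'.1 hz') (AffineSubspace.mem_mk'.1 hz)

theorem parallelogram (hf : MapsLinesAlong K L f G) (hx : x ∈ G) (hy : y ∈ G)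
    (hxy : y ∉ K ∙ x) (p : V) : f (p + y + x) - f (p + y) = f (p + x) - f p := by
  have hyx := notMem_span_singleton_symm (hf.ne_zero hx) hxy
  -- The defect lies in the direction of the image of the line along `x` and in that of the image
  -- of the line along `y`.
  refine sub_eq_zero.1 (Submodule.disjoint_def.1 (hf.disjoint_vectorSpan hx hy hxy p) _ ?_ ?_)
  · exact sub_mem (hf.vectorSpan_add_eq hx hy hxy p ▸ sub_mem_vectorSpan (p + y) x)
      (sub_mem_vectorSpan p x)
  · rw [sub_sub_sub_comm, add_right_comm]
    exact sub_mem (hf.vectorSpan_add_eq hy hx hyx p ▸ sub_mem_vectorSpan (p + x) y)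
      (sub_mem_vectorSpan p y)

theorem sub_eq_sub (hf : MapsLinesAlong K L f G) (hG : IsAmple K G) (hy : y ∈ G) (p : V) :
    f (p + y) - f p = f y - f 0 := by
  have hperiodic (z : V) : Function.Periodic (fun p => f (p + y) - f p) z := by
    have hz : z ∈ AddSubgroup.closure (G \ (K ∙ y : Submodule K V)) :=
      hG.closure_sdiff y hy ▸ AddSubgroup.mem_top z
    induction hz using AddSubgroup.closure_induction with
    | mem x hx => exact fun p => hf.parallelogram hy hx.1 hx.2 p
    | zero => exact fun p => by simp only [add_zero]
    | add _ _ _ _ h₁ h₂ => exact h₁.add_period h₂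
    | neg _ _ h => exact h.neg
  simpa only [zero_add] using hperiodic p 0

theorem exists_addMonoidHom (hf : MapsLinesAlong K L f G) (hG : IsAmple K G) :
    ∃ g : V →+ W, ∀ x, f x = g x + f 0 := by
  have hadd (z : V) : ∀ p, f (p + z) - f p = f z - f 0 := by
    have hz : z ∈ AddSubgroup.closure G := hG.closure_eq_top ▸ AddSubgroup.mem_top z
    induction hz using AddSubgroup.closure_induction with
    | mem y hy => exact hf.sub_eq_sub hG hy
    | zero => exact fun p => by rw [add_zero, sub_self, sub_self]
    | add x y _ _ hx hy =>
      intro p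
      rw [← add_assoc, ← sub_add_sub_cancel, hy, hx, ← sub_add_sub_cancel (f (x + y)) (f x), hy]
    | neg y _ hy =>
      intro p
      have h₁ := hy (p + -y)
      have h₂ := hy (-y)
      rw [neg_add_cancel_right] at h₁
      rw [neg_add_cancel] at h₂
      rw [← neg_sub (f p), h₁, ← h₂, neg_sub]
  refine ⟨AddMonoidHom.mk' (fun x => f x - f 0) fun x y => ?_, fun x => (sub_add_cancel _ _).symm⟩
  rw [← sub_add_sub_cancel, hadd y x, add_comm]

theorem image_span_singleton_eq (hf : MapsLinesAlong K L f G) {g : V →+ W}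
    (hg : ∀ x, f x = g x + f 0) (hx : x ∈ G) :
    g '' (K ∙ x : Submodule K V) = (L ∙ g x : Submodule L W) := by
  let D := vectorSpan L (f '' AffineSubspace.mk' (0 : V) (K ∙ x))
  have hline := hf.isFlat_line x hx 0
  have hmem (w : W) : w ∈ g '' (K ∙ x : Submodule K V) ↔ w ∈ D := by
    have h0 : f 0 ∈ f '' AffineSubspace.mk' (0 : V) (K ∙ x) :=
      Set.mem_image_of_mem f (AffineSubspace.self_mem_mk' 0 _)
    rw [← add_sub_cancel_right w (f 0), hline.sub_mem_vectorSpan_iff h0, add_sub_cancel_right]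
    have hf' (y : V) : f y = w + f 0 ↔ g y = w := by rw [hg, add_left_inj]
    simp only [Set.mem_image, SetLike.mem_coe, AffineSubspace.mem_mk', vsub_eq_sub, sub_zero, hf']
  have hgx : g x ≠ 0 := fun h => hf.ne_zero hx (hf.injective (by rw [hg, h, zero_add]))
  have hgxD : g x ∈ D := (hmem _).1 (Set.mem_image_of_mem g (Submodule.mem_span_singleton_self x))
  have hspan : L ∙ g x = D :=
    Submodule.eq_of_le_of_finrank_eq ((Submodule.span_singleton_le_iff_mem _ _).2 hgxD)
      ((finrank_span_singleton hgx).trans hline.finrank_vectorSpan.symm)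
  rw [hspan]
  exact Set.ext hmem

theorem smul_factor_eq_of_sumAdj (hf : MapsLinesAlong K L f G) {g : V →+ W}
    (hg : ∀ x, f x = g x + f 0) {σ : V → K → L}
    (hσ : ∀ x ∈ G, ∀ c, g (c • x) = σ x c • g x) (hxy : SumAdj K G x y) : σ x = σ y := by
  obtain ⟨hx, hy, hyx, hs⟩ := hxy
  have hginj : Function.Injective g := fun a b h => hf.injective (by rw [hg, hg b, h])
  have hindep : LinearIndependent L ![g x, g y] := by
    have hgx : g x ≠ 0 := (map_ne_zero_iff g hginj).2 (hf.ne_zero hx)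
    refine (LinearIndependent.pair_iff' hgx).2 fun a ha => hyx ?_
    have hgy : g y ∈ (L ∙ g x : Submodule L W) := Submodule.mem_span_singleton.2 ⟨a, ha⟩
    rw [← SetLike.mem_coe, ← hf.image_span_singleton_eq hg hx] at hgy
    obtain ⟨z, hz, hzy⟩ := hgy
    exact hginj hzy ▸ hz
  ext c
  have hc := hσ _ hs c
  rw [smul_add, map_add, map_add, smul_add, hσ x hx, hσ y hy] at hc
  obtain ⟨h₁, h₂⟩ := hindep.eq_of_pair hc
  exact h₁.trans h₂.symm

theorem exists_map_smul_eq (hf : MapsLinesAlong K L f G) (hG : IsAmple K G) {g : V →+ W}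
    (hg : ∀ x, f x = g x + f 0) : ∃ σ : K → L, ∀ c x, g (c • x) = σ c • g x := by
  have hline (x : V) (c : K) : ∃ d : L, x ∈ G → g (c • x) = d • g x := by
    by_cases hx : x ∈ G
    · have hmem : g (c • x) ∈ (L ∙ g x : Submodule L W) := by
        rw [← SetLike.mem_coe, ← hf.image_span_singleton_eq hg hx]
        exact Set.mem_image_of_mem g
          (Submodule.smul_mem _ c (Submodule.mem_span_singleton_self x))
      obtain ⟨d, hd⟩ := Submodule.mem_span_singleton.1 hmem
      exact ⟨d, fun _ => hd.symm⟩
    · exact ⟨0, fun h => absurd h hx⟩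
  choose σ hσ using hline
  have hconst {x y : V} (h : Relation.EqvGen (SumAdj K G) x y) : σ x = σ y := by
    induction h with
    | rel _ _ h => exact hf.smul_factor_eq_of_sumAdj hg (fun x hx c => hσ x c hx) h
    | refl => rfl
    | symm _ _ _ ih => exact ih.symm
    | trans _ _ _ _ _ ih₁ ih₂ => exact ih₁.trans ih₂
  obtain ⟨y, hy⟩ := hG.nonempty
  refine ⟨σ y, fun c x => ?_⟩
  have hx : x ∈ AddSubgroup.closure G := hG.closure_eq_top ▸ AddSubgroup.mem_top x
  induction hx using AddSubgroup.closure_induction with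
  | mem x hx => rw [hσ x c hx, hconst (hG.eqvGen x hx y hy)]
  | zero => simp only [smul_zero, map_zero]
  | add _ _ _ _ h₁ h₂ => rw [smul_add, map_add, map_add, smul_add, h₁, h₂]
  | neg _ _ h => rw [smul_neg, map_neg, map_neg, smul_neg, h]

theorem exists_isSemiaffine (hf : MapsLinesAlong K L f G) (hG : IsAmple K G) :
    ∃ σ : K ≃+* L, IsSemiaffine σ f := by
  obtain ⟨g, hg⟩ := hf.exists_addMonoidHom hG
  obtain ⟨σ, hσ⟩ := hf.exists_map_smul_eq hG hg
  obtain ⟨x, hx⟩ := hG.nonempty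
  have hginj : Function.Injective g := fun a b h => hf.injective (by rw [hg, hg b, h])
  obtain ⟨τ, hτ⟩ := exists_ringEquiv_of_map_smul hginj hσ (hf.ne_zero hx) fun d => by
    have hd : d • g x ∈ g '' (K ∙ x : Submodule K V) := by
      rw [hf.image_span_singleton_eq hg hx]
      exact Submodule.smul_mem _ d (Submodule.mem_span_singleton_self _)
    obtain ⟨_, hz, hzd⟩ := hd
    obtain ⟨c, rfl⟩ := Submodule.mem_span_singleton.1 hz
    exact ⟨c, hzd⟩
  exact ⟨τ, ⟨⟨g, fun c v => by simp [hσ, hτ]⟩, hg⟩⟩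

end MapsLinesAlong

end Fundamental

section NonzeroVectors

variable {K V : Type*} [DivisionRing K] [AddCommGroup V] [Module K V] {x y : V}

theorem exists_notMem_span_singleton (h2 : 2 ≤ finrank K V) (x : V) : ∃ y, y ∉ K ∙ x := by
  by_contra! h
  have hle := finrank_span_le_card (R := K) ({x} : Set V)
  rw [Submodule.eq_top_iff'.2 h, finrank_top, Set.toFinset_singleton, Finset.card_singleton] at hle
  exact absurd (h2.trans hle) (by decide)

theorem ne_zero_of_notMem_span_singleton (h : y ∉ K ∙ x) : y ≠ 0 :=
  fun hy => h (hy ▸ zero_mem _)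

theorem sumAdj_ne_zero (hx : x ≠ 0) (hy : y ∉ K ∙ x) : SumAdj K {z | z ≠ 0} x y :=
  ⟨hx, ne_zero_of_notMem_span_singleton hy, hy, fun h => hy <| by
    rw [eq_neg_of_add_eq_zero_right h]
    exact neg_mem (Submodule.mem_span_singleton_self x)⟩

theorem isAmple_ne_zero (h2 : 2 ≤ finrank K V) : IsAmple K {x : V | x ≠ 0} where
  nonempty :=
    (exists_notMem_span_singleton h2 (0 : V)).imp fun _ => ne_zero_of_notMem_span_singleton
  closure_sdiff y _ := by
    have hmem {w : V} (hw : w ∉ K ∙ y) :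
        w ∈ AddSubgroup.closure ({x | x ≠ 0} \ (K ∙ y : Submodule K V)) :=
      AddSubgroup.subset_closure ⟨ne_zero_of_notMem_span_singleton hw, hw⟩
    refine eq_top_iff.2 fun v _ => ?_
    by_cases hv : v ∈ K ∙ y
    · obtain ⟨z, hz⟩ := exists_notMem_span_singleton h2 y
      rw [← add_sub_cancel_right v z]
      exact sub_mem (hmem fun h => hz (((K ∙ y).add_mem_iff_right hv).1 h)) (hmem hz)
    · exact hmem hv
  eqvGen x hx y hy := by
    by_cases hxy : y ∈ K ∙ x
    · obtain ⟨z, hz⟩ := exists_notMem_span_singleton h2 x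
      exact .trans _ _ _ (.rel _ _ (sumAdj_ne_zero hx hz)) (.symm _ _ (.rel _ _
        (sumAdj_ne_zero hy fun h => hz ((Submodule.span_singleton_le_iff_mem _ _).2 hxy h))))
    · exact .rel _ _ (sumAdj_ne_zero hx hxy)

end NonzeroVectors

section Semiaffine

variable {K L M V W X : Type*} [DivisionRing K] [DivisionRing L] [DivisionRing M]
  [AddCommGroup V] [AddCommGroup W] [AddCommGroup X] [Module K V] [Module L W] [Module M X]

theorem mapsLinesAlong_ne_zero {f : V → W} (hinj : Function.Injective f)
    (hline : ∀ A : Set V, IsFlat K 1 A → IsFlat L 1 (f '' A))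
    (hplane : ∀ A : Set V, IsFlat K 2 A → IsFlat L 2 (f '' A)) :
    MapsLinesAlong K L f {x | x ≠ 0} where
  injective := hinj
  isFlat_line _ hx p := hline _ (isFlat_mk'_span_singleton p hx)
  exists_plane x hx y _ hy p := by
    have hrank : finrank K (Submodule.span K {x, y}) = 2 := by
      have hindep : LinearIndependent K ![x, y] := (LinearIndependent.pair_iff' hx).2 fun a ha =>
        hy (Submodule.mem_span_singleton.2 ⟨a, ha⟩)
      rw [← Matrix.range_cons_cons_empty x y ![], finrank_span_eq_card hindep, Fintype.card_fin]
    exact ⟨_, hplane _ (hrank ▸ isFlat_mk' p _), subset_rfl⟩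

theorem exists_isSemiaffine_of_isFlat_image [FiniteDimensional L W] {f : V → W}
    (h2 : 2 ≤ finrank K V) (hinj : Function.Injective f)
    (hline : ∀ A : Set V, IsFlat K 1 A → IsFlat L 1 (f '' A))
    (hplane : ∀ A : Set V, IsFlat K 2 A → IsFlat L 2 (f '' A)) :
    ∃ σ : K ≃+* L, IsSemiaffine σ f :=
  (mapsLinesAlong_ne_zero hinj hline hplane).exists_isSemiaffine (isAmple_ne_zero h2)

theorem IsFlatEmbedding.exists_isSemiaffine {L' : Type*} [DivisionRing L'] [Module L' W]
    [FiniteDimensional K V] [FiniteDimensional L W] [FiniteDimensional L' W]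
    [EquidimBimodule L L' W] {f : V → W} {l : Set V} (hf : IsFlatEmbedding K L L' f)
    (h3 : 2 < finrank K V) (hl : IsFlat K 1 l) (hfl : IsPurelyFlat L L' 1 (f '' l)) :
    ∃ σ : K ≃+* L, IsSemiaffine σ f := by
  have hline (m : Set V) (hm : IsFlat K 1 m) : IsFlat L 1 (f '' m) :=
    hf.isFlat_image_line_of_isPurelyFlat h3 hl hfl hm
  exact exists_isSemiaffine_of_isFlat_image h3.le hf.injective hline fun _ hA =>
    hf.isFlat_image_plane_of_forall_line hline hA

theorem IsSemiaffine.exists_isFlat_image {σ : K ≃+* L} {f : V → W} (hf : IsSemiaffine σ f) {d : ℕ}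
    {A : Set V} (hA : IsFlat K d A) : ∃ e, IsFlat L e (f '' A) := by
  obtain ⟨g, hg⟩ := hf
  obtain ⟨p, hp⟩ := hA.nonempty
  have himage : f '' A = AffineSubspace.mk' (f p) ((vectorSpan K A).map g) := by
    conv_lhs => rw [← hA.coe_mk'_vectorSpan hp]
    ext w
    constructor
    · rintro ⟨x, hx, rfl⟩
      refine AffineSubspace.mem_mk'.2 ⟨x - p, AffineSubspace.mem_mk'.1 hx, ?_⟩
      rw [map_sub, hg x, hg p, vsub_eq_sub, add_sub_add_right_eq_sub]
    · rintro ⟨v, hv, hvw⟩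
      refine ⟨v + p, AffineSubspace.mem_mk'.2 (by simpa using hv), ?_⟩
      rw [hg, map_add, hvw, add_assoc, ← hg, vsub_eq_sub, sub_add_cancel]
  exact ⟨_, himage ▸ isFlat_mk' (f p) _⟩

theorem IsSemiaffine.comp {σ : K ≃+* L} {τ : L ≃+* M} {f : V → W} (hf : IsSemiaffine σ f)
    (h : W →ₛₗ[(τ : L →+* M)] X) : IsSemiaffine (σ.trans τ) (h ∘ f) := by
  obtain ⟨g, hg⟩ := hf
  have : RingHomCompTriple (σ : K →+* L) (τ : L →+* M) (σ.trans τ : K ≃+* M) := ⟨rfl⟩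
  exact ⟨h.comp g, fun x => by
    rw [Function.comp_apply, Function.comp_apply, hg, map_add, LinearMap.comp_apply]⟩

end Semiaffine

section Coordinates

variable {k ι : Type*} [DivisionRing k]

theorem exists_bijOn_restrict [Finite ι] (S : Submodule k (ι → k)) :
    ∃ J : Finset ι, Set.BijOn J.restrict (S : Set (ι → k)) Set.univ := by
  classical
  have := Fintype.ofFinite ι
  let separating : Set (Finset ι) := {J | ∀ v ∈ S, (∀ i ∈ J, v i = 0) → v = 0}
  obtain ⟨J, hJ, hmin⟩ := (Set.toFinite separating).exists_minimal
    ⟨Finset.univ, fun v _ h => funext fun i => h i (Finset.mem_univ i)⟩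
  have hex (i : J) : ∃ v ∈ S, J.restrict v = Pi.single i 1 := by
    have hi : J.erase i ∉ separating := fun h =>
      J.notMem_erase i.1 (hmin h (Finset.erase_subset i.1 J) i.2)
    obtain ⟨v, hv, hv0, hne⟩ : ∃ v ∈ S, (∀ j ∈ J.erase i, v j = 0) ∧ v ≠ 0 := by
      by_contra! h
      exact hi h
    have hvi : v i ≠ 0 := fun h => hne <| hJ v hv fun j hj => by
      by_cases hji : j = i
      · exact hji ▸ h
      · exact hv0 j (Finset.mem_erase.2 ⟨hji, hj⟩)
    refine ⟨(v i)⁻¹ • v, S.smul_mem _ hv, funext fun j => ?_⟩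
    by_cases hji : j = i
    · simp [hji, hvi]
    · simp [hji, hv0 j (Finset.mem_erase.2 ⟨Subtype.coe_injective.ne hji, j.2⟩)]
  choose v hv hvJ using hex
  refine ⟨J, Set.mapsTo_univ _ _, fun x hx y hy hxy => ?_, fun w _ =>
    ⟨∑ i, w i • v i, S.sum_mem fun i _ => S.smul_mem _ (hv i), funext fun j => ?_⟩⟩
  · exact sub_eq_zero.1 (hJ _ (S.sub_mem hx hy) fun i hi => sub_eq_zero.2 (congrFun hxy ⟨i, hi⟩))
  · have hvj (i : J) : v i j = Pi.single (M := fun _ : J => k) i 1 j := congrFun (hvJ i) j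
    simp [Finset.sum_apply, hvj, Pi.single_apply]

theorem finrank_eq_card_of_bijOn_restrict {K : Type*} [DivisionRing K] [Module K k]
    (hK : finrank K k = 1) (S : Submodule K (ι → k)) {J : Finset ι}
    (hJ : Set.BijOn J.restrict (S : Set (ι → k)) Set.univ) : finrank K S = J.card := by
  have : FiniteDimensional K k := .of_finrank_pos (hK ▸ one_pos)
  let r : S →ₗ[K] (J → k) := (LinearMap.funLeft K k Subtype.val).comp S.subtype
  have hr : Function.Bijective r :=
    ⟨fun v w h => Subtype.ext (hJ.injOn v.2 w.2 h), fun w => by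
      obtain ⟨v, hv, hvw⟩ := hJ.surjOn (Set.mem_univ w)
      exact ⟨⟨v, hv⟩, hvw⟩⟩
  rw [(LinearEquiv.ofBijective r hr).finrank_eq, finrank_pi_fintype]
  simp [hK]

theorem finrank_mulOpposite : finrank kᵐᵒᵖ k = 1 := by
  rw [(MulOpposite.opLinearEquiv kᵐᵒᵖ : k ≃ₗ[kᵐᵒᵖ] kᵐᵒᵖ).finrank_eq, finrank_self]

instance finiteDimensional_mulOpposite : FiniteDimensional kᵐᵒᵖ k :=
  (MulOpposite.opLinearEquiv kᵐᵒᵖ : k ≃ₗ[kᵐᵒᵖ] kᵐᵒᵖ).symm.finiteDimensional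

instance equidimBimodule_mulOpposite [Finite ι] : EquidimBimodule k kᵐᵒᵖ (ι → k) where
  finrank_eq S S' h := by
    obtain ⟨J, hJ⟩ := exists_bijOn_restrict S
    rw [finrank_eq_card_of_bijOn_restrict (finrank_self k) S hJ,
      finrank_eq_card_of_bijOn_restrict finrank_mulOpposite S' (h ▸ hJ)]

end Coordinates

section PurelyLeftLines

theorem IsFlat.smul_mem_of_mk' {K K' V : Type*} [DivisionRing K] [DivisionRing K']
    [AddCommGroup V] [Module K V] [Module K' V] {d : ℕ} {p v : V} {S : Submodule K V}
    (h : IsFlat K' d (AffineSubspace.mk' p S : Set V)) (hv : v ∈ S) (c : K') : c • v ∈ S := by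
  have hmem (w : V) :
      w ∈ vectorSpan K' (AffineSubspace.mk' p S : Set V) ↔ w ∈ S := by
    rw [← add_sub_cancel_right w p, h.sub_mem_vectorSpan_iff (AffineSubspace.self_mem_mk' p S),
      SetLike.mem_coe, AffineSubspace.mem_mk', vsub_eq_sub]
  exact (hmem _).1 (Submodule.smul_mem _ c ((hmem v).2 hv))

variable {k ι : Type*} [DivisionRing k]

theorem commute_of_op_smul_mem_span_singleton {x : ι → k} {i : ι} (hi : x i ≠ 0) {c : k}
    (h : MulOpposite.op c • x ∈ k ∙ x) (j : ι) : Commute ((x i)⁻¹ * x j) c := by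
  obtain ⟨a, ha⟩ := Submodule.mem_span_singleton.1 h
  have hl (l : ι) : a * x l = x l * c := congrFun ha l
  have hai : a = x i * c * (x i)⁻¹ := (eq_mul_inv_iff_mul_eq₀ hi).2 (hl i)
  change (x i)⁻¹ * x j * c = c * ((x i)⁻¹ * x j)
  rw [mul_assoc, ← hl j, hai]
  simp only [mul_assoc, inv_mul_cancel_left₀ hi]

theorem isPurelyFlat_mk'_span_singleton {x : ι → k} {i j : ι} (hi : x i ≠ 0)
    (hij : (x i)⁻¹ * x j ∉ Subring.center k) (p : ι → k) :
    IsPurelyFlat k kᵐᵒᵖ 1 (AffineSubspace.mk' p (k ∙ x) : Set (ι → k)) := by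
  refine ⟨isFlat_mk'_span_singleton p fun hx => hi (congrFun hx i), fun h => hij ?_⟩
  refine Subring.mem_center_iff.2 fun c => (commute_of_op_smul_mem_span_singleton hi ?_ j).symm
  exact h.smul_mem_of_mk' (Submodule.mem_span_singleton_self x) (MulOpposite.op c)

theorem exists_isPurelyFlat_subset [Finite ι] {μ : k} (hμ : μ ∉ Subring.center k)
    {P : Set (ι → k)} (hP : IsFlat k 2 P) : ∃ l ⊆ P, IsPurelyFlat k kᵐᵒᵖ 1 l := by
  classical
  obtain ⟨p, hp⟩ := hP.nonempty
  obtain ⟨J, hJ⟩ := exists_bijOn_restrict (vectorSpan k P)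
  have hcard : J.card = 2 := by
    rw [← finrank_eq_card_of_bijOn_restrict (finrank_self k) _ hJ, hP.finrank_vectorSpan]
  obtain ⟨i, j, hij, rfl⟩ := Finset.card_eq_two.1 hcard
  obtain ⟨x, hx, hxJ⟩ := hJ.surjOn
    (Set.mem_univ fun l : ({i, j} : Finset ι) => if l.1 = i then 1 else μ)
  have hxi : x i = 1 := by simpa using congrFun hxJ ⟨i, by simp⟩
  have hxj : x j = μ := by simpa [hij.symm] using congrFun hxJ ⟨j, by simp⟩
  refine ⟨_, fun y hy => ?_, isPurelyFlat_mk'_span_singleton (j := j) (hxi ▸ one_ne_zero)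
    (by rwa [hxi, hxj, inv_one, one_mul]) p⟩
  exact (hP.sub_mem_vectorSpan_iff hp).1
    ((Submodule.span_singleton_le_iff_mem _ _).2 hx (AffineSubspace.mem_mk'.1 hy))

end PurelyLeftLines

section CentralMatrix

variable {k ι κ : Type*} [DivisionRing k]

/-- For every noncentral `μ`, the left linear map with rows `M i` sends the right line spanned by
`e i + μ • e j` into a right line. -/
def PreservesNoncentralLines (M : ι → κ → k) : Prop :=
  ∀ i j, i ≠ j → ∀ μ ∉ Subring.center k, ∀ c : k,
    c • M i + (μ * c) • M j ∈ kᵐᵒᵖ ∙ (M i + μ • M j)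

theorem mul_eq_mul_of_mem_center {z w μ c c' m : k} (hz : z ∈ Subring.center k)
    (hw : w ∈ Subring.center k) (hμ : μ ∉ Subring.center k) (hzw : z ≠ 0 ∨ w ≠ 0)
    (h : c * (z * m) + μ * c * (w * m) = (z * m + μ * (w * m)) * c') : c * m = m * c' := by
  have hs : z + μ * w ≠ 0 := by
    intro h0
    have hw0 : w = 0 := by
      by_contra hw0
      refine hμ ?_
      rw [(eq_mul_inv_iff_mul_eq₀ hw0).2 (eq_neg_of_add_eq_zero_right h0)]
      exact mul_mem (neg_mem hz) (Set.inv_mem_center hw)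
    rw [hw0, mul_zero, add_zero] at h0
    exact hzw.elim (absurd h0) (absurd hw0)
  refine mul_left_cancel₀ hs ?_
  calc (z + μ * w) * (c * m) = z * c * m + μ * (w * c) * m := by noncomm_ring
    _ = c * (z * m) + μ * c * (w * m) := by
      rw [← Subring.mem_center_iff.1 hz, ← Subring.mem_center_iff.1 hw]
      noncomm_ring
    _ = (z + μ * w) * (m * c') := by
      rw [h]
      noncomm_ring

namespace PreservesNoncentralLines

variable {M : ι → κ → k} {i j : ι} {l l' : κ} {μ : k}

theorem exists_mul_eq (hM : PreservesNoncentralLines M) (hij : i ≠ j)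
    (hμ : μ ∉ Subring.center k) (c : k) :
    ∃ c' : k, ∀ l, c * M i l + μ * c * M j l = (M i l + μ * M j l) * c' := by
  obtain ⟨c', hc'⟩ := Submodule.mem_span_singleton.1 (hM i j hij μ hμ c)
  exact ⟨c'.unop, fun l => (congrFun hc' l).symm⟩

theorem mul_inv_mem_center (hM : PreservesNoncentralLines M) (i : ι) (hj : M j l ≠ 0) :
    M i l * (M j l)⁻¹ ∈ Subring.center k := by
  by_contra hcenter
  have hij : i ≠ j := by
    rintro rfl
    exact hcenter (mul_inv_cancel₀ hj ▸ one_mem _)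
  refine hcenter (Subring.mem_center_iff.2 fun c => ?_)
  obtain ⟨c', hc'⟩ := hM.exists_mul_eq hij (mt neg_mem_iff.1 hcenter) c
  have h := hc' l
  simp only [neg_mul] at h
  rw [inv_mul_cancel_right₀ hj, add_neg_cancel, zero_mul, add_neg_eq_zero] at h
  rw [← mul_assoc, h, mul_inv_cancel_right₀ hj]

theorem mul_eq_mul {r : ι} (hM : PreservesNoncentralLines M) (hr : M r l ≠ 0)
    (hμ : μ ∉ Subring.center k) (hl : M i l ≠ 0 ∨ M j l ≠ 0) {c c' : k}
    (h : c * M i l + μ * c * M j l = (M i l + μ * M j l) * c') : c * M r l = M r l * c' := by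
  have hquot (i : ι) : M i l = M i l * (M r l)⁻¹ * M r l := (inv_mul_cancel_right₀ hr _).symm
  have hne {i : ι} (hi : M i l ≠ 0) : M i l * (M r l)⁻¹ ≠ 0 := mul_ne_zero hi (inv_ne_zero hr)
  rw [hquot i, hquot j] at h
  exact mul_eq_mul_of_mem_center (hM.mul_inv_mem_center i hr) (hM.mul_inv_mem_center j hr) hμ
    (hl.imp hne hne) h

variable [Nontrivial ι]

theorem mul_inv_mem_center_of_columns {r r' : ι} (hM : PreservesNoncentralLines M)
    (hr : M r l ≠ 0) (hr' : M r' l' ≠ 0) : M r l * (M r' l')⁻¹ ∈ Subring.center k := by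
  by_contra hμ
  obtain ⟨i, j, hij, hl, hl'⟩ :
      ∃ i j, i ≠ j ∧ (M i l ≠ 0 ∨ M j l ≠ 0) ∧ (M i l' ≠ 0 ∨ M j l' ≠ 0) := by
    rcases eq_or_ne r r' with rfl | h
    · obtain ⟨j, hj⟩ := exists_ne r
      exact ⟨r, j, hj.symm, .inl hr, .inl hr'⟩
    · exact ⟨r, r', h, .inl hr, .inr hr'⟩
  refine hμ (Subring.mem_center_iff.2 fun c => ?_)
  obtain ⟨c', hc'⟩ := hM.exists_mul_eq hij hμ c
  have h := hM.mul_eq_mul hr hμ hl (hc' l)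
  have h' := hM.mul_eq_mul hr' hμ hl' (hc' l')
  have hinv : c' * (M r' l')⁻¹ = (M r' l')⁻¹ * c := by
    rw [eq_inv_mul_iff_mul_eq₀ hr', ← mul_assoc, ← h', mul_inv_cancel_right₀ hr']
  rw [← mul_assoc, h, mul_assoc, mul_assoc, hinv]

theorem exists_inv_mul_mem_center [Nonempty κ] (hM : PreservesNoncentralLines M)
    (hcol : ∀ l, ∃ i, M i l ≠ 0) : ∃ a : k, a ≠ 0 ∧ ∀ i l, a⁻¹ * M i l ∈ Subring.center k := by
  obtain ⟨l₀⟩ := ‹Nonempty κ›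
  obtain ⟨r₀, hr₀⟩ := hcol l₀
  refine ⟨M r₀ l₀, hr₀, fun i l => ?_⟩
  obtain ⟨r, hr⟩ := hcol l
  have hz : M i l * (M r₀ l₀)⁻¹ ∈ Subring.center k := by
    have := mul_mem (hM.mul_inv_mem_center i hr) (hM.mul_inv_mem_center_of_columns hr hr₀)
    rwa [← mul_assoc, inv_mul_cancel_right₀ hr] at this
  have hcomm := Subring.mem_center_iff.1 hz (M r₀ l₀)
  rw [inv_mul_cancel_right₀ hr₀] at hcomm
  rwa [← hcomm, inv_mul_cancel_left₀ hr₀]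

end PreservesNoncentralLines

end CentralMatrix

section StandardForm

theorem IsFlat.sub_mem_span_singleton {K V : Type*} [DivisionRing K] [AddCommGroup V] [Module K V]
    [FiniteDimensional K V] {l : Set V} {p q r : V} (hl : IsFlat K 1 l) (hp : p ∈ l) (hq : q ∈ l)
    (hr : r ∈ l) (hpq : p ≠ q) : r - p ∈ K ∙ (q - p) := by
  have hl' := isFlat_mk'_span_singleton (K := K) p (sub_ne_zero.2 hpq.symm)
  have heq := hl.eq_of_mem_of_mem hl' hpq hp hq (AffineSubspace.self_mem_mk' p _)
    (AffineSubspace.mem_mk'.2 (Submodule.mem_span_singleton_self _))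
  exact AffineSubspace.mem_mk'.1 (heq ▸ hr : r ∈ (AffineSubspace.mk' p _ : Set V))

theorem IsSemiaffine.smul_mem_of_isFlat_image {K K' L V W : Type*} [DivisionRing K]
    [DivisionRing K'] [DivisionRing L] [AddCommGroup V] [AddCommGroup W] [Module K V] [Module K' V]
    [Module L W] {σ : K ≃+* L} {f : V → W} (hf : IsSemiaffine σ f) (hinj : Function.Injective f)
    {S : Submodule K' V} {d : ℕ} (hS : IsFlat L d (f '' AffineSubspace.mk' (0 : V) S)) {v : V}
    (hv : v ∈ S) (c : K) : c • v ∈ S := by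
  obtain ⟨g, hg⟩ := hf
  have hmem (w : V) : f w ∈ f '' AffineSubspace.mk' (0 : V) S ↔ w ∈ S := by
    rw [hinj.mem_set_image, SetLike.mem_coe, AffineSubspace.mem_mk', vsub_eq_sub, sub_zero]
  have hspan (w : V) : g w ∈ vectorSpan L (f '' AffineSubspace.mk' (0 : V) S) ↔ w ∈ S := by
    rw [← hmem, ← hS.sub_mem_vectorSpan_iff ((hmem 0).2 S.zero_mem), hg w, add_sub_cancel_right]
  rw [← hspan] at hv ⊢
  rw [map_smulₛₗ]
  exact Submodule.smul_mem _ _ hv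

variable {k : Type*} [DivisionRing k]

theorem op_smul_single_add_single {ι : Type*} [DecidableEq ι] (i j : ι) (μ c : k) :
    MulOpposite.op c • (Pi.single i 1 + Pi.single j μ : ι → k) =
      c • Pi.single i 1 + (μ * c) • Pi.single j 1 := by
  ext l
  simp [Pi.single_apply]

theorem smul_single_add_single_notMem {ι : Type*} [DecidableEq ι] {i j : ι} (hij : i ≠ j)
    {μ c : k} (hc : ¬ Commute μ c) :
    c • (Pi.single i 1 + Pi.single j μ : ι → k) ∉
      kᵐᵒᵖ ∙ (Pi.single i 1 + Pi.single j μ : ι → k) := by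
  intro h
  obtain ⟨d, hd⟩ := Submodule.mem_span_singleton.1 h
  have hi : d.unop = c := by simpa [hij] using congrFun hd i
  have hj : μ * d.unop = c * μ := by simpa [hij.symm] using congrFun hd j
  exact hc (hi ▸ hj)

theorem preservesNoncentralLines_of_isMixedFlat_image {ι κ : Type*} [DecidableEq ι] [Finite κ]
    {σ : k ≃+* k} {g : (ι → k) →ₛₗ[(σ : k →+* k)] (κ → k)}
    {h : (ι → k) → κ → k} (hg : ∀ x, h x = g x + h 0) (hinj : Function.Injective h)
    (hf : ∀ A : Set (ι → k), IsFlat kᵐᵒᵖ 1 A → IsMixedFlat k kᵐᵒᵖ 1 (h '' A)) :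
    PreservesNoncentralLines fun i => g (Pi.single i 1) := by
  intro i j hij μ hμ c
  obtain ⟨μ, rfl⟩ := σ.surjective μ
  obtain ⟨c, rfl⟩ := σ.surjective c
  set v : ι → k := Pi.single i 1 + Pi.single j μ with hv
  have hgv (a : k) : g (MulOpposite.op a • v) =
      σ a • g (Pi.single i 1) + (σ μ * σ a) • g (Pi.single j 1) := by
    rw [op_smul_single_add_single, map_add, map_smulₛₗ, map_smulₛₗ, ← map_mul σ]
    rfl
  have hv0 : v ≠ 0 := fun h0 => by simpa [hv, hij] using congrFun h0 i
  obtain ⟨a, ha⟩ : ∃ a, ¬ Commute μ a := by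
    by_contra! h
    refine hμ (Subring.mem_center_iff.2 fun a => ?_)
    rw [← σ.apply_symm_apply a, ← map_mul, ← map_mul, (h _).eq]
  have hmem (w : ι → k) (hw : w ∈ kᵐᵒᵖ ∙ v) :
      h w ∈ h '' AffineSubspace.mk' (0 : ι → k) (kᵐᵒᵖ ∙ v) :=
    ⟨w, by simpa using hw, rfl⟩
  rcases hf _ (isFlat_mk'_span_singleton 0 hv0) with hl | hl
  · exact absurd (IsSemiaffine.smul_mem_of_isFlat_image ⟨g, hg⟩ hinj hl
      (Submodule.mem_span_singleton_self v) a) (smul_single_add_single_notMem hij ha)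
  · have hvmem := Submodule.mem_span_singleton_self (R := kᵐᵒᵖ) v
    have key := hl.sub_mem_span_singleton (hmem 0 (zero_mem _)) (hmem v hvmem)
      (hmem _ (Submodule.smul_mem _ (MulOpposite.op c) hvmem)) (hinj.ne hv0.symm)
    rw [hg v, hg (_ • v), add_sub_cancel_right, add_sub_cancel_right, hgv] at key
    have h1 := hgv 1
    rw [MulOpposite.op_one, one_smul, map_one, one_smul, mul_one] at h1
    rwa [h1] at key

theorem map_apply_eq_sum_single {n : ℕ} {L W : Type*} [DivisionRing L] [AddCommGroup W] [Module L W]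
    {σ : k →+* L} (g : (Fin n → k) →ₛₗ[σ] W) (x : Fin n → k) :
    g x = ∑ i, σ (x i) • g (Pi.single i 1) := by
  conv_lhs => rw [pi_eq_sum_univ' x]
  simp only [map_sum, map_smulₛₗ]

theorem IsSemiaffine.hasStandardForm {n : ℕ} (hn : 2 ≤ n) {σ : k ≃+* k}
    {h : (Fin n → k) → (Fin n → k)} (hσ : IsSemiaffine σ h) (hbij : Function.Bijective h)
    (hf : ∀ A : Set (Fin n → k), IsFlat kᵐᵒᵖ 1 A → IsMixedFlat k kᵐᵒᵖ 1 (h '' A)) :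
    HasStandardForm h := by
  have := Fin.nontrivial_iff_two_le.2 hn
  obtain ⟨g, hg⟩ := hσ
  have hcol (l : Fin n) : ∃ i, g (Pi.single i 1) l ≠ 0 := by
    by_contra! h0
    obtain ⟨x, hx⟩ := hbij.2 (Pi.single l 1 + h 0)
    rw [hg, add_left_inj, map_apply_eq_sum_single] at hx
    simpa [h0] using congrFun hx l
  obtain ⟨a, ha, hcenter⟩ :=
    (preservesNoncentralLines_of_isMixedFlat_image hg hbij.1 hf).exists_inv_mul_mem_center hcol
  let M : Matrix (Fin n) (Fin n) k := .of fun i j => σ.symm (a⁻¹ * g (Pi.single i 1) j)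
  refine ⟨σ.symm a, fun j => σ.symm (h 0 j), σ, M.vecMulLinear, fun i j => ?_, fun x j => ?_⟩
  · rw [Matrix.vecMulLinear_apply, Matrix.single_one_vecMul]
    refine Subring.mem_center_iff.2 fun c => σ.injective ?_
    simpa [M] using Subring.mem_center_iff.1 (hcenter i j) (σ c)
  · rw [congrFun (hg x) j, map_apply_eq_sum_single]
    simp [M, Matrix.vecMul, dotProduct, mul_assoc, ha]

end StandardForm

section GenericVectors

theorem exists_notMem_notMem {A : Type*} [AddGroup A] {H H' : AddSubgroup A} {x y : A}
    (hx : x ∉ H) (hy : y ∉ H') : ∃ z, z ∉ H ∧ z ∉ H' := by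
  by_cases hx' : x ∈ H'
  · by_cases hy' : y ∈ H
    · exact ⟨x + y, fun h => hx ((H.add_mem_cancel_right hy').1 h),
        fun h => hy ((H'.add_mem_cancel_left hx').1 h)⟩
    · exact ⟨y, hy', hy⟩
  · exact ⟨x, hx, hx'⟩

variable {k : Type*} [DivisionRing k] {c d q r s t : k}

theorem mem_centralizer_singleton_iff_commute : q ∈ Subring.centralizer {c} ↔ Commute q c := by
  simp only [Subring.mem_centralizer_iff, Set.mem_singleton_iff, forall_eq]
  exact eq_comm

theorem exists_not_commute (hc : c ∉ Subring.center k) : ∃ q, ¬ Commute q c := by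
  by_contra! h
  exact hc (Subring.mem_center_iff.2 h)

theorem notMem_center_of_not_commute (h : ¬ Commute c d) : c ∉ Subring.center k :=
  fun hc => h (Subring.mem_center_iff.1 hc d).symm

theorem exists_not_commute_not_commute (hc : c ∉ Subring.center k) (hd : d ∉ Subring.center k) :
    ∃ q, ¬ Commute q c ∧ ¬ Commute q d := by
  obtain ⟨x, hx⟩ := exists_not_commute hc
  obtain ⟨y, hy⟩ := exists_not_commute hd
  simp only [← mem_centralizer_singleton_iff_commute] at hx hy ⊢
  exact exists_notMem_notMem (H := (Subring.centralizer {c}).toAddSubgroup)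
    (H' := (Subring.centralizer {d}).toAddSubgroup) hx hy

theorem exists_not_commute_not_commute_mul (hc : c ∉ Subring.center k) (hr : r ≠ 0) :
    ∃ q, ¬ Commute q c ∧ ¬ Commute (r * q) c := by
  obtain ⟨x, hx⟩ := exists_not_commute hc
  rw [← mem_centralizer_singleton_iff_commute] at hx
  simp only [← mem_centralizer_singleton_iff_commute]
  refine exists_notMem_notMem (H := (Subring.centralizer {c}).toAddSubgroup)
    (H' := (Subring.centralizer {c}).toAddSubgroup.comap (AddMonoidHom.mulLeft r))
    (y := r⁻¹ * x) hx ?_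
  rwa [AddSubgroup.mem_comap, AddMonoidHom.coe_mulLeft, mul_inv_cancel_left₀ hr]

variable (k) in
/-- The vectors `(s, s * c)` of `k ^ 2` with `s ≠ 0` and `c` not central: those whose left span is
not a right subspace, so that all lines in their direction are purely left. -/
def genericVectors : Set (Fin 2 → k) :=
  {v | v 0 ≠ 0 ∧ (v 0)⁻¹ * v 1 ∉ Subring.center k}

theorem vec_mem_genericVectors (hs : s ≠ 0) (hc : c ∉ Subring.center k) :
    ![s, s * c] ∈ genericVectors k :=
  ⟨hs, by simpa [hs] using hc⟩

theorem exists_eq_vec_of_mem_genericVectors {v : Fin 2 → k} (hv : v ∈ genericVectors k) :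
    ∃ s c, s ≠ 0 ∧ c ∉ Subring.center k ∧ v = ![s, s * c] := by
  refine ⟨v 0, (v 0)⁻¹ * v 1, hv.1, hv.2, ?_⟩
  rw [mul_inv_cancel_left₀ hv.1]
  exact funext (Fin.forall_fin_two.2 ⟨rfl, rfl⟩)

theorem vec_notMem_span_singleton (ht : t ≠ 0) (hcd : c ≠ d) :
    ![t, t * d] ∉ k ∙ ![s, s * c] := by
  intro h
  obtain ⟨a, ha⟩ := Submodule.mem_span_singleton.1 h
  have h0 : a * s = t := congrFun ha 0
  have h1 : a * (s * c) = t * d := congrFun ha 1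
  rw [← mul_assoc, h0] at h1
  exact hcd (mul_left_cancel₀ ht h1)

theorem vec_mem_closure_genericVectors_sdiff (hcd : ¬ Commute c d) (s t : k) :
    ![s, s * c] ∈ AddSubgroup.closure (genericVectors k \ (k ∙ ![t, t * d])) := by
  rcases eq_or_ne s 0 with rfl | hs
  · rw [zero_mul, show ![0, 0] = (0 : Fin 2 → k) from funext (Fin.forall_fin_two.2 ⟨rfl, rfl⟩)]
    exact zero_mem _
  · refine AddSubgroup.subset_closure ⟨vec_mem_genericVectors hs (notMem_center_of_not_commute hcd),
      vec_notMem_span_singleton hs ?_⟩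
    rintro rfl
    exact hcd (Commute.refl _)

theorem closure_genericVectors_sdiff {y : Fin 2 → k} (hy : y ∈ genericVectors k) :
    AddSubgroup.closure (genericVectors k \ (k ∙ y)) = ⊤ := by
  obtain ⟨t, d, -, hd, rfl⟩ := exists_eq_vec_of_mem_genericVectors hy
  obtain ⟨c, hc⟩ := exists_not_commute hd
  have hc' : ¬ Commute (c + 1) d := fun h => hc (by simpa using h.sub_left (Commute.one_left d))
  refine eq_top_iff.2 fun v _ => ?_
  have hv : v = ![v 0, v 0 * c] + (![v 1 - v 0 * c, (v 1 - v 0 * c) * (c + 1)] -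
      ![v 1 - v 0 * c, (v 1 - v 0 * c) * c]) := by
    ext i
    fin_cases i <;> simp [mul_add]
  rw [hv]
  exact add_mem (vec_mem_closure_genericVectors_sdiff hc _ t)
    (sub_mem (vec_mem_closure_genericVectors_sdiff hc' _ t)
      (vec_mem_closure_genericVectors_sdiff hc _ t))

theorem sumAdj_vec (hs : s ≠ 0) (ht : t ≠ 0) (hc : c ∉ Subring.center k)
    (hd : d ∉ Subring.center k) (hcd : c ≠ d) {u e : k} (hu : u ≠ 0) (he : e ∉ Subring.center k)
    (h0 : s + t = u) (h1 : s * c + t * d = u * e) :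
    SumAdj k (genericVectors k) ![s, s * c] ![t, t * d] := by
  refine ⟨vec_mem_genericVectors hs hc, vec_mem_genericVectors ht hd,
    vec_notMem_span_singleton ht hcd, ?_⟩
  convert vec_mem_genericVectors hu he using 1
  simp [h0, h1]

theorem sumAdj_vec_add_one (hs : s ≠ 0) (hqc : ¬ Commute q c) :
    SumAdj k (genericVectors k) ![s, s * c] ![s * q, s * q * (c + 1)] := by
  have hc := notMem_center_of_not_commute fun h => hqc h.symm
  have hq : q ≠ 0 := fun h => hqc (h ▸ Commute.zero_left c)
  have hq1 : ¬ Commute (1 + q) c := fun h => hqc (by simpa using h.sub_left (Commute.one_left c))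
  have hq0 : 1 + q ≠ 0 := fun h => hq1 (h ▸ Commute.zero_left c)
  refine sumAdj_vec hs (mul_ne_zero hs hq) hc (fun h => hc (by simpa using sub_mem h (one_mem _)))
    (by simp) (e := c + 1 - (1 + q)⁻¹) (mul_ne_zero hs hq0) (fun he => hq1 ?_)
    (by noncomm_ring) ?_
  · have he' : Commute (c + 1 - (1 + q)⁻¹) c := (Subring.mem_center_iff.1 he c).symm
    have hinv := ((Commute.refl c).add_left (Commute.one_left c)).sub_left he'
    rw [sub_sub_cancel] at hinv
    exact (Commute.inv_left_iff₀).1 hinv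
  · rw [mul_sub, mul_assoc s _ (1 + q)⁻¹, mul_inv_cancel₀ hq0]
    noncomm_ring

theorem sumAdj_vec_one_sub (hcd : ¬ Commute c d) :
    SumAdj k (genericVectors k) ![1 - c, (1 - c) * c] ![c, c * d] := by
  have hc := notMem_center_of_not_commute hcd
  have hc0 : c ≠ 0 := fun h => hcd (h ▸ Commute.zero_left d)
  have hc1 : 1 - c ≠ 0 := fun h => hcd (sub_eq_zero.1 h ▸ Commute.one_left d)
  refine sumAdj_vec hc1 hc0 hc (notMem_center_of_not_commute fun h => hcd h.symm)
    (fun h => hcd (h ▸ Commute.refl c)) (e := c - c * c + c * d) one_ne_zero (fun he => hcd ?_)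
    (sub_add_cancel 1 c) (by noncomm_ring)
  have he' : Commute c (c - c * c + c * d) := Subring.mem_center_iff.1 he c
  have hmul := he'.sub_right
    ((Commute.refl c).sub_right ((Commute.refl c).mul_right (Commute.refl c)))
  rw [add_sub_cancel_left] at hmul
  exact mul_left_cancel₀ hc0 (hmul.eq.trans (mul_assoc c d c))

theorem eqvGen_vec (hs : s ≠ 0) (ht : t ≠ 0) (hc : c ∉ Subring.center k) :
    Relation.EqvGen (SumAdj k (genericVectors k)) ![s, s * c] ![t, t * c] := by
  obtain ⟨q, hq, hq'⟩ := exists_not_commute_not_commute_mul hc (mul_ne_zero (inv_ne_zero ht) hs)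
  have h := sumAdj_vec_add_one ht hq'
  rw [← mul_assoc t, mul_inv_cancel_left₀ ht] at h
  exact .trans _ _ _ (.rel _ _ (sumAdj_vec_add_one hs hq)) (.symm _ _ (.rel _ _ h))

theorem eqvGen_vec_of_not_commute (hs : s ≠ 0) (ht : t ≠ 0) (hcd : ¬ Commute c d) :
    Relation.EqvGen (SumAdj k (genericVectors k)) ![s, s * c] ![t, t * d] := by
  have hc0 : c ≠ 0 := fun h => hcd (h ▸ Commute.zero_left d)
  have hc1 : 1 - c ≠ 0 := fun h => hcd (sub_eq_zero.1 h ▸ Commute.one_left d)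
  exact .trans _ _ _ (eqvGen_vec hs hc1 (notMem_center_of_not_commute hcd)) <|
    .trans _ _ _ (.rel _ _ (sumAdj_vec_one_sub hcd)) <|
      eqvGen_vec hc0 ht (notMem_center_of_not_commute fun h => hcd h.symm)

theorem isAmple_genericVectors (hc : c ∉ Subring.center k) : IsAmple k (genericVectors k) where
  nonempty := ⟨_, vec_mem_genericVectors one_ne_zero hc⟩
  closure_sdiff _ := closure_genericVectors_sdiff
  eqvGen := by
    intro x hx y hy
    obtain ⟨s, c, hs, hc, rfl⟩ := exists_eq_vec_of_mem_genericVectors hx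
    obtain ⟨t, d, ht, hd, rfl⟩ := exists_eq_vec_of_mem_genericVectors hy
    obtain ⟨q, hqc, hqd⟩ := exists_not_commute_not_commute hc hd
    exact .trans _ _ _ (.symm _ _ (eqvGen_vec_of_not_commute one_ne_zero hs hqc))
      (eqvGen_vec_of_not_commute one_ne_zero ht hqd)

end GenericVectors

section Antiautomorphisms

variable {k : Type*} [DivisionRing k] {ι : Type*}

/-- An anti-automorphism `ε` of `k`, viewed as an isomorphism from the opposite ring to `k`. -/
def ringEquivOfAnti (ε : k ≃+* kᵐᵒᵖ) : kᵐᵒᵖ ≃+* k := (RingEquiv.op ε).trans (RingEquiv.opOp k).symm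

/-- The anti-automorphism `ε` applied coordinatewise, as a semilinear map from the left to the
right structure. -/
def antiMapLeft (ε : k ≃+* kᵐᵒᵖ) : (ι → k) →ₛₗ[(ε : k →+* kᵐᵒᵖ)] (ι → k) where
  toFun x i := (ε (x i)).unop
  map_add' x y := funext fun i => by simp
  map_smul' c x := funext fun i => by simp

/-- The anti-automorphism `ε` applied coordinatewise, as a semilinear map from the right to the
left structure. -/
def antiMapRight (ε : k ≃+* kᵐᵒᵖ) : (ι → k) →ₛₗ[(ringEquivOfAnti ε : kᵐᵒᵖ →+* k)] (ι → k) where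
  toFun x i := (ε (x i)).unop
  map_add' x y := funext fun i => by simp
  map_smul' c x := funext fun i => by simp [ringEquivOfAnti]

theorem antiMapRight_injective (ε : k ≃+* kᵐᵒᵖ) :
    Function.Injective (antiMapRight ε : (ι → k) → (ι → k)) := fun _ _ h =>
  funext fun i => ε.injective (MulOpposite.unop_injective (congrFun h i))

theorem isSemiaffine_coe {K L V W : Type*} [DivisionRing K] [DivisionRing L] [AddCommGroup V]
    [AddCommGroup W] [Module K V] [Module L W] {σ : K ≃+* L} (g : V →ₛₗ[(σ : K →+* L)] W) :
    IsSemiaffine σ g :=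
  ⟨g, fun x => by rw [map_zero, add_zero]⟩

end Antiautomorphisms

section CoordinateSpace

variable {k : Type*} [DivisionRing k] {n : ℕ} {f : (Fin n → k) → (Fin n → k)}
  {A L P : Set (Fin n → k)} {d e : ℕ}

theorem IsLeftAffine.isFlat (h : IsLeftAffine A) : IsFlat k (leftDim A) A :=
  ⟨h.1, h.2, rfl⟩

theorem IsRightAffine.isFlat (h : IsRightAffine A) : IsFlat kᵐᵒᵖ (rightDim A) A :=
  ⟨h.1, h.2, rfl⟩

theorem IsFlat.isLeftAffine (h : IsFlat k d A) : IsLeftAffine A :=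
  ⟨h.nonempty, h.exists_coe_eq⟩

theorem IsFlat.isRightAffine (h : IsFlat kᵐᵒᵖ d A) : IsRightAffine A :=
  ⟨h.nonempty, h.exists_coe_eq⟩

theorem IsPurelyFlat.isPurelyLeftLine (h : IsPurelyFlat k kᵐᵒᵖ 1 L) : IsPurelyLeftLine L := by
  have : EquidimBimodule kᵐᵒᵖ k (Fin n → k) := equidimBimodule_mulOpposite.symm
  refine ⟨h.1.isLeftAffine, fun hr => h.2 ?_, h.1.finrank_vectorSpan⟩
  have hdim : rightDim L = 1 :=
    (hr.isFlat.le_of_subset' h.1 subset_rfl).antisymm (h.1.le_of_subset' hr.isFlat subset_rfl)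
  exact hdim ▸ hr.isFlat

theorem IsPurelyLeftLine.isPurelyFlat (h : IsPurelyLeftLine L) : IsPurelyFlat k kᵐᵒᵖ 1 L :=
  ⟨h.2.2 ▸ h.1.isFlat, fun hr => h.2.1 hr.isRightAffine⟩

theorem finrank_mulOpposite_fin_fun : finrank kᵐᵒᵖ (Fin n → k) = n := by
  simp [finrank_pi_fintype, finrank_mulOpposite]

/-- The map `f` sends every left or right affine subspace to a left or right affine subspace. -/
def MapsAffine (f : (Fin n → k) → (Fin n → k)) : Prop :=
  ∀ A : Set (Fin n → k), IsLeftAffine A ∨ IsRightAffine A →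
    IsLeftAffine (f '' A) ∨ IsRightAffine (f '' A)

namespace MapsAffine

theorem exists_isMixedFlat_image (hf : MapsAffine f) (hA : IsMixedFlat k kᵐᵒᵖ d A) :
    ∃ e, IsMixedFlat k kᵐᵒᵖ e (f '' A) := by
  rcases hf A (hA.imp IsFlat.isLeftAffine IsFlat.isRightAffine) with h | h
  · exact ⟨_, .inl h.isFlat⟩
  · exact ⟨_, .inr h.isFlat⟩

theorem bijective (hf : MapsAffine f) (hinj : Function.Injective f) : Function.Bijective f :=
  ⟨hinj, surjective_of_isMixedFlat_image (K := k) (L := k) (L' := kᵐᵒᵖ) hinj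
    (fun _ _ hA => hf.exists_isMixedFlat_image (.inl hA)) rfl⟩

theorem isMixedFlat_image (hf : MapsAffine f) (hinj : Function.Injective f)
    (hA : IsMixedFlat k kᵐᵒᵖ d A) : IsMixedFlat k kᵐᵒᵖ d (f '' A) := by
  rcases hA with hA | hA
  · exact hA.isMixedFlat_image hinj (fun _ _ hA => hf.exists_isMixedFlat_image (.inl hA)) rfl
  · exact hA.isMixedFlat_image hinj (fun _ _ hA => hf.exists_isMixedFlat_image (.inr hA))
      (by rw [finrank_mulOpposite_fin_fun, finrank_fin_fun])

theorem dim_eq (hf : MapsAffine f) (hinj : Function.Injective f) (hA : IsMixedFlat k kᵐᵒᵖ d A)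
    (he : IsMixedFlat k kᵐᵒᵖ e (f '' A)) : e = d :=
  have h := hf.isMixedFlat_image hinj hA
  (he.le_of_subset h subset_rfl).antisymm (h.le_of_subset he subset_rfl)

theorem isFlatEmbedding (hf : MapsAffine f) (hinj : Function.Injective f) :
    IsFlatEmbedding k k kᵐᵒᵖ f :=
  ⟨hinj, fun hA => hf.isMixedFlat_image hinj (.inl hA)⟩

theorem not_isFlat_image_and (hf : MapsAffine f) (hinj : Function.Injective f)
    (hL : IsPurelyFlat k kᵐᵒᵖ 1 L) :
    ¬ (IsFlat k 1 (f '' L) ∧ IsFlat kᵐᵒᵖ 1 (f '' L)) := by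
  rintro ⟨hl, hr⟩
  obtain ⟨x, hx⟩ := hL.1.nonempty
  obtain ⟨y, hy, hyx⟩ := hL.1.exists_ne x
  have hm : IsFlat kᵐᵒᵖ 1 (line[kᵐᵒᵖ, y, x] : Set (Fin n → k)) := isFlat_line hyx
  have hyA := Set.mem_image_of_mem f hy
  have hxA := Set.mem_image_of_mem f hx
  have hym := Set.mem_image_of_mem f (left_mem_affineSpan_pair kᵐᵒᵖ y x)
  have hxm := Set.mem_image_of_mem f (right_mem_affineSpan_pair kᵐᵒᵖ y x)
  suffices heq : f '' line[kᵐᵒᵖ, y, x] = f '' L from hL.2 (hinj.image_injective heq ▸ hm)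
  rcases hf.isMixedFlat_image hinj (.inr hm) with h | h
  · exact h.eq_of_mem_of_mem hl (hinj.ne hyx) hym hxm hyA hxA
  · exact h.eq_of_mem_of_mem hr (hinj.ne hyx) hym hxm hyA hxA

theorem exists_isSemiaffine (hf : MapsAffine f) (hinj : Function.Injective f) (hn : 2 < n)
    (hL : IsPurelyFlat k kᵐᵒᵖ 1 L) (h : IsFlat k 1 (f '' L)) :
    ∃ σ : k ≃+* k, IsSemiaffine σ f :=
  (hf.isFlatEmbedding hinj).exists_isSemiaffine (by rwa [finrank_fin_fun]) hL.1
    ⟨h, fun h' => hf.not_isFlat_image_and hinj hL ⟨h, h'⟩⟩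

theorem exists_isSemiaffine_mulOpposite (hf : MapsAffine f) (hinj : Function.Injective f)
    (hn : 2 < n) (hL : IsPurelyFlat k kᵐᵒᵖ 1 L) (h : IsFlat kᵐᵒᵖ 1 (f '' L)) :
    ∃ σ : k ≃+* kᵐᵒᵖ, IsSemiaffine σ f :=
  have : EquidimBimodule kᵐᵒᵖ k (Fin n → k) := equidimBimodule_mulOpposite.symm
  (hf.isFlatEmbedding hinj).symm.exists_isSemiaffine (by rwa [finrank_fin_fun]) hL.1
    ⟨h, fun h' => hf.not_isFlat_image_and hinj hL ⟨h', h⟩⟩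

theorem antiMapRight_comp (hf : MapsAffine f) (ε : k ≃+* kᵐᵒᵖ) :
    MapsAffine (antiMapRight ε ∘ f) := by
  intro A hA
  rw [Set.image_comp]
  rcases hf A hA with h | h
  · obtain ⟨e, he⟩ := (isSemiaffine_coe (antiMapLeft ε)).exists_isFlat_image h.isFlat
    exact .inr he.isRightAffine
  · obtain ⟨e, he⟩ := (isSemiaffine_coe (antiMapRight ε)).exists_isFlat_image h.isFlat
    exact .inl he.isLeftAffine

theorem preservesLeftAffine (hf : MapsAffine f) (hinj : Function.Injective f) {σ : k ≃+* k}
    (hσ : IsSemiaffine σ f) : PreservesLeftAffine f := by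
  intro A hA
  obtain ⟨e, he⟩ := hσ.exists_isFlat_image hA.isFlat
  exact ⟨he.isLeftAffine,
    he.finrank_vectorSpan.trans (hf.dim_eq hinj (.inl hA.isFlat) (.inl he))⟩

theorem hasStandardForm (hf : MapsAffine f) (hinj : Function.Injective f) (hn : 2 ≤ n)
    {σ : k ≃+* k} (hσ : IsSemiaffine σ f) : HasStandardForm f :=
  hσ.hasStandardForm hn (hf.bijective hinj) fun _ hA => hf.isMixedFlat_image hinj (.inr hA)

end MapsAffine

theorem IsFlat.mulOpposite_of_center_eq_top {ι : Type*} [Finite ι]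
    (hk : Subring.center k = ⊤) {A : Set (ι → k)} (hA : IsFlat k d A) : IsFlat kᵐᵒᵖ d A := by
  obtain ⟨p, hp⟩ := hA.nonempty
  have hsmul (c : kᵐᵒᵖ) (x : ι → k) : c • x = c.unop • x := funext fun i =>
    Subring.mem_center_iff.1 (hk ▸ Subring.mem_top c.unop) (x i)
  let S : Submodule kᵐᵒᵖ (ι → k) :=
    { (vectorSpan k A).toAddSubmonoid with
      smul_mem' := fun c x hx => hsmul c x ▸ (vectorSpan k A).smul_mem c.unop hx }
  have hS : (AffineSubspace.mk' p S : Set (ι → k)) = A := hA.coe_mk'_vectorSpan hp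
  rw [← hA.finrank_vectorSpan, EquidimBimodule.finrank_eq (vectorSpan k A) S rfl, ← hS]
  exact isFlat_mk' p S

theorem mapsLinesAlong_genericVectors {f : (Fin 2 → k) → (Fin 2 → k)}
    (hinj : Function.Injective f)
    (hf : ∀ L : Set (Fin 2 → k), IsPurelyFlat k kᵐᵒᵖ 1 L → IsFlat kᵐᵒᵖ 1 (f '' L)) :
    MapsLinesAlong k kᵐᵒᵖ f (genericVectors k) where
  injective := hinj
  isFlat_line x hx p := hf _ (isPurelyFlat_mk'_span_singleton hx.1 hx.2 p)
  exists_plane x _ y _ _ p := by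
    have h := isFlat_univ (K := kᵐᵒᵖ) (V := Fin 2 → k)
    rw [finrank_mulOpposite_fin_fun] at h
    exact ⟨Set.univ, h, Set.subset_univ _⟩

theorem MapsAffine.exists_isSemiaffine_mulOpposite_of_plane (hf : MapsAffine f)
    (hinj : Function.Injective f) (hP : IsFlat k 2 P)
    (h : ∀ L ⊆ P, IsPurelyFlat k kᵐᵒᵖ 1 L → IsFlat kᵐᵒᵖ 1 (f '' L)) :
    ∃ σ : k ≃+* kᵐᵒᵖ, IsSemiaffine σ f := by
  have hn : 2 ≤ n := by simpa using hP.le_of_subset isFlat_univ (Set.subset_univ P)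
  by_cases hk : Subring.center k = ⊤
  · have himage (d : ℕ) (A : Set (Fin n → k)) (hA : IsFlat k d A) : IsFlat kᵐᵒᵖ d (f '' A) :=
      (hf.isMixedFlat_image hinj (.inl hA)).elim (IsFlat.mulOpposite_of_center_eq_top hk) id
    exact exists_isSemiaffine_of_isFlat_image (by rwa [finrank_fin_fun]) hinj (himage 1) (himage 2)
  obtain ⟨c, hc⟩ : ∃ c, c ∉ Subring.center k := by
    simpa [Subring.eq_top_iff'] using hk
  rcases hn.eq_or_lt with rfl | hn
  · have huniv := isFlat_univ (K := k) (V := Fin 2 → k)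
    rw [finrank_fin_fun] at huniv
    obtain rfl : P = Set.univ := hP.eq_of_subset huniv (Set.subset_univ P)
    exact (mapsLinesAlong_genericVectors hinj fun L => h L (Set.subset_univ L)).exists_isSemiaffine
      (isAmple_genericVectors hc)
  · obtain ⟨L, hLP, hL⟩ := exists_isPurelyFlat_subset hc hP
    exact hf.exists_isSemiaffine_mulOpposite hinj hn hL (h L hLP hL)

end CoordinateSpace

theorem theorem1_general {k : Type*} [DivisionRing k] {n : ℕ} (f : (Fin n → k) → (Fin n → k))
    (hinj : Function.Injective f)
    (hf : ∀ A : Set (Fin n → k), IsLeftAffine A ∨ IsRightAffine A →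
      IsLeftAffine (f '' A) ∨ IsRightAffine (f '' A)) :
    (Function.Bijective f ∧
      ∀ A : Set (Fin n → k),
        (IsLeftAffine A →
          (IsLeftAffine (f '' A) → leftDim (f '' A) = leftDim A) ∧
          (IsRightAffine (f '' A) → rightDim (f '' A) = leftDim A)) ∧
        (IsRightAffine A →
          (IsLeftAffine (f '' A) → leftDim (f '' A) = rightDim A) ∧
          (IsRightAffine (f '' A) → rightDim (f '' A) = rightDim A))) ∧
    (3 ≤ n → ∀ L : Set (Fin n → k), IsPurelyLeftLine L → IsLeftAffine (f '' L) →
      PreservesLeftAffine f ∧ HasStandardForm f) ∧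
    ∀ P : Set (Fin n → k), IsLeftAffine P → leftDim P = 2 →
      (∀ L : Set (Fin n → k), IsPurelyLeftLine L → L ⊆ P → IsRightAffine (f '' L)) →
      Nonempty (k ≃+* kᵐᵒᵖ) ∧
      ∀ ε : k ≃+* kᵐᵒᵖ,
        PreservesLeftAffine (fun x i => (ε (f x i)).unop) ∧
        HasStandardForm (fun x i => (ε (f x i)).unop) := by
  replace hf : MapsAffine f := hf
  refine ⟨⟨hf.bijective hinj, fun A => ⟨fun hA => ⟨fun h => ?_, fun h => ?_⟩,
    fun hA => ⟨fun h => ?_, fun h => ?_⟩⟩⟩, fun hn L hL hfL => ?_, fun P hP hP2 h => ?_⟩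
  · exact hf.dim_eq hinj (.inl hA.isFlat) (.inl h.isFlat)
  · exact hf.dim_eq hinj (.inl hA.isFlat) (.inr h.isFlat)
  · exact hf.dim_eq hinj (.inr hA.isFlat) (.inl h.isFlat)
  · exact hf.dim_eq hinj (.inr hA.isFlat) (.inr h.isFlat)
  · obtain ⟨σ, hσ⟩ := hf.exists_isSemiaffine hinj hn hL.isPurelyFlat
      (hf.dim_eq hinj (.inl hL.isPurelyFlat.1) (.inl hfL.isFlat) ▸ hfL.isFlat)
    exact ⟨hf.preservesLeftAffine hinj hσ, hf.hasStandardForm hinj (by omega) hσ⟩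
  · have hP' : IsFlat k 2 P := hP2 ▸ hP.isFlat
    have hn : 2 ≤ n := by simpa using hP'.le_of_subset isFlat_univ (Set.subset_univ P)
    obtain ⟨σ, hσ⟩ := hf.exists_isSemiaffine_mulOpposite_of_plane hinj hP' fun L hLP hL =>
      have hfL := (h L hL.isPurelyLeftLine hLP).isFlat
      hf.dim_eq hinj (.inl hL.1) (.inr hfL) ▸ hfL
    refine ⟨⟨σ⟩, fun ε => ?_⟩
    have hεf := hf.antiMapRight_comp ε
    have hεinj := (antiMapRight_injective ε).comp hinj
    have hεσ := hσ.comp (antiMapRight ε)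
    exact ⟨hεf.preservesLeftAffine hεinj hεσ, hεf.hasStandardForm hεinj hn hεσ⟩

theorem theorem1 {k : Type*} [DivisionRing k] {n : ℕ} (f : (Fin n → k) → (Fin n → k))
    (hinj : Function.Injective f)
    (hf : ∀ A : Set (Fin n → k), IsLeftAffine A ∨ IsRightAffine A →
      IsLeftAffine (f '' A) ∨ IsRightAffine (f '' A)) :
    -- (1)
    (Function.Bijective f ∧
      ∀ A : Set (Fin n → k),
        (IsLeftAffine A →
          (IsLeftAffine (f '' A) → leftDim (f '' A) = leftDim A) ∧
          (IsRightAffine (f '' A) → rightDim (f '' A) = leftDim A)) ∧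
        (IsRightAffine A →
          (IsLeftAffine (f '' A) → leftDim (f '' A) = rightDim A) ∧
          (IsRightAffine (f '' A) → rightDim (f '' A) = rightDim A))) ∧
    -- (2) and (3)
    ∀ P : Set (Fin n → k), IsTwoSidedPlane P →
      (3 ≤ n →
        (∃ L : Set (Fin n → k), IsPurelyLeftLine L ∧ L ⊆ P ∧ IsLeftAffine (f '' L)) →
        PreservesLeftAffine f ∧ HasStandardForm f) ∧
      (2 ≤ n →
        (∀ L : Set (Fin n → k), IsPurelyLeftLine L → L ⊆ P → IsRightAffine (f '' L)) →
        Nonempty (k ≃+* kᵐᵒᵖ) ∧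
        ∀ ε : k ≃+* kᵐᵒᵖ,
          PreservesLeftAffine (fun x i => (ε (f x i)).unop) ∧
          HasStandardForm (fun x i => (ε (f x i)).unop)) := by
  obtain ⟨h1, h2, h3⟩ := theorem1_general f hinj hf
  exact ⟨h1, fun P hP => ⟨fun hn ⟨L, hL, _, hfL⟩ => h2 hn L hL hfL, fun _ => h3 P hP.1 hP.2.2⟩⟩
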